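/- **Conventions.** Let $q$ be a prime power, $n\ge 10$, $n'=n-4$. For subspaces of $\mathbb F_q^N$ put $d_S(X,Y)=\dim X+\dim Y-2\dim(X\cap Y)$ and $d_I(X,Y)=\max\{\dim X,\dim Y\}-\dim(X\cap Y)$. The identifying vector $v\in\{0,1\}^n$ of a subspace $X$ has its ones at the pivot columns of the reduced row echelon form $\mathrm{RE}(X)$. The Ferrers diagram $\mathcal F_v$ of $v$ has a row for each one of $v$ and a column for each zero of $v$; the row of the one at position $i$ has dots exactly in the columns $j>i$. A set of dots $D\subseteq\mathcal F_v$ has, for rank distance $d$, the bound $\min_{0\le i\le d-1}w_i$, where $w_i$ is the number of dots of $D$ in neither the first $i$ rows nor the rightmost $d-1-i$ columns. An FDMRD code for $D$ with rank distance $d$ is a linear space of matrices over $\mathbb F_q$ that vanish outside $D$, whose distinct members differ by a matrix of rank at least $d$, and whose dimension is that bound. Lifting a matrix $A$ that vanishes outside $\mathcal F_v$ means taking the subspace $X$ with identifying vector $v$ for which $\mathrm{RE}(X)$ with the pivot columns removed is $A$. The pending dot of $\mathcal F_v$ is the leftmost dot of its first row, provided that its removal does not change the bound for $d=2$. **Classes.**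 Identify a weight-2 vector of length $n'$ with an edge of the complete graph $K_{n'}$ on $\{1,\dots,n'\}$. If $n'$ is odd, $P_i$ is the set of edges $\{a,b\}$ with $a+b\equiv 2i \pmod{n'}$. If $n'$ is even, $P_i$ consists of the edges $\{a,b\}$, $a,b\le n'-1$, with $a+b\equiv 2i\pmod{n'-1}$, and of the edge $\{a,n'\}$ with $a\le n'-1$, $a\equiv i\pmod{n'-1}$ (so $P_{n'}=P_1$). These are the (nearly) perfect matchings of the circle construction. **Construction C-4.** Use the identifying vectors $$\mathcal A_0=\{(1111\|0\cdots0)\},\quad \mathcal A_1=\{(1100\|v),(0011\|v): v\in P_{\lceil n'/2\rceil+1}\},\quad \mathcal A_2=\{(1001\|v),(0110\|v): v\in P_2\},$$ $$\mathcal A_3=\{(1010\|v),(0101\|v): v\in P_j,\ j\in J\},$$ $$J=\{\lceil \tfrac{n'}2\rceil+i: 2\le i\le \min\{\lceil \tfrac q2\rceil+1,\lfloor \tfrac{n'}2\rfloor\}\}\cup\{i: 3\le i\le\min\{\lfloor \tfrac q2\rfloor+2,\lceil \tfrac{n'}2\rceil\}\}.$$ For each $v\in\mathcal A_0\cup\mathcal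 A_1\cup\mathcal A_2$ lift all members of an FDMRD code for $\mathcal F_v$ with rank distance 2. For each $v\in\mathcal A_3$ take an FDMRD code with rank distance 2 for $\mathcal F_v$ without its pending dot, and lift its members after putting at the pending dot an element of $\mathbb F_q$ that depends only on the prefix of $v$ and on the class $P_j$ of its suffix, with different elements for different classes with the same prefix. Finally add a code $\mathbb S$ of $4$-dimensional subspaces of $\mathbb F_q^{n-4}$, any two distinct ones at injection distance at least $2$, with four zeros put in front of every vector. The union is $\mathbb C^4$. Write $A^*_q(n-4,2,4)=|\mathbb S|$ (in particular $\mathbb S$ may be a largest known, or a largest, such code). **Theorem.** For every such $\mathbb S$ the construction can be carried out, and for all choices in it (FDMRD codes and values of the pending dots) $\mathbb C^4$ is a set of $4$-dimensional subspaces of $\mathbb F_q^n$ whose minimum subspace distance is exactly $4$, and $|\mathbb C^4|$ is equal to $$q^{3(n-4)}+(q^{n-4}+q^{n-6})\Big[q^{2(n-6)}+(\tfrac n2-4)q^{n-7}+q^{\frac n2-4}\Big]+(q^{n-5}+q^{n-6})\Big[\sum_{i=2}^{\min\{\lceil\frac q2\rceil+1,\lfloor\frac{n'}2\rfloor\}}\big(iq^{2n-2i-10}+(\tfrac{n-6}2-i)q^{n-2i-5}+q^{\frac{n-6}2-i}\big)$$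 $$+\sum_{i=1}^{\min\{\lfloor\frac q2\rfloor+1,\lceil\frac{n'}2\rceil-1\}}\big(iq^{2n-2i-11}+(\tfrac{n-6}2-i)q^{n-2i-6}+q^{n-i-6}\big)\Big]+A^*_q(n-4,2,4)$$ if $n$ is even, and $$q^{3(n-4)}+(q^{n-4}+q^{n-6})\Big[q^{2(n-6)}+\tfrac{n-7}2q^{n-8}\Big]+(q^{n-5}+q^{n-6})\Big[\sum_{i=2}^{\min\{\lceil\frac q2\rceil+1,\lfloor\frac{n'}2\rfloor\}}\big(iq^{2n-2i-10}+(\tfrac{n-5}2-i)q^{n-2i-6}\big)$$ $$+\sum_{i=1}^{\min\{\lfloor\frac q2\rfloor+1,\lceil\frac{n'}2\rceil-1\}}\big(iq^{2n-2i-11}+(\tfrac{n-5}2-i)q^{n-2i-7}\big)\Big]+A^*_q(n-4,2,4)$$ if $n$ is odd. -/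

import Mathlib

section Metrics

variable {F : Type*} [Field F] {V : Type*} [AddCommGroup V] [Module F V]

/-- Subspace distance `dim X + dim Y - 2 dim (X ∩ Y)`. -/
noncomputable def subspaceDist (X Y : Submodule F V) : ℕ :=
  Module.finrank F X + Module.finrank F Y - 2 * Module.finrank F (X ⊓ Y : Submodule F V)

/-- Injection distance `max (dim X) (dim Y) - dim (X ∩ Y)`. -/
noncomputable def injectionDist (X Y : Submodule F V) : ℕ :=
  max (Module.finrank F X) (Module.finrank F Y) - Module.finrank F (X ⊓ Y : Submodule F V)

/-- `C` consists of `k`-dimensional subspaces, distinct ones having injection distance at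
least `d`. -/
def IsConstantDimCode (C : Set (Submodule F V)) (d k : ℕ) : Prop :=
  (∀ X ∈ C, Module.finrank F X = k) ∧
    ∀ X ∈ C, ∀ Y ∈ C, X ≠ Y → d ≤ injectionDist X Y

/-- The minimum subspace distance of `C` exists and is equal to `d`. -/
def HasMinSubspaceDist (C : Set (Submodule F V)) (d : ℕ) : Prop :=
  IsLeast {e : ℕ | ∃ X ∈ C, ∃ Y ∈ C, X ≠ Y ∧ e = subspaceDist X Y} d

end Metrics

/-- The concatenation `(x || y)`, of length `n`, of vectors of lengths `k` and `n - k`. -/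
def concatVec {α : Type*} {k n : ℕ} (x : Fin k → α) (y : Fin (n - k) → α) : Fin n → α :=
  fun i => if h : i.1 < k then x ⟨i.1, h⟩ else y ⟨i.1 - k, by omega⟩

/-- The linear map appending `k` zeros in front of a vector of length `n - k`. -/
def padZeros (F : Type*) [Field F] (k n : ℕ) : (Fin (n - k) → F) →ₗ[F] (Fin n → F) where
  toFun y := concatVec (0 : Fin k → F) y
  map_add' y z := by
    funext i
    by_cases h : i.1 < k <;> simp [concatVec, h]
  map_smul' c y := by
    funext i
    by_cases h : i.1 < k <;> simp [concatVec, h]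

section Ferrers

variable {n : ℕ}

/-- The positions of the ones of a binary vector `v`. If `v` is the identifying vector of a
subspace they index the rows of its reduced row echelon form: the row of `i` is the one whose
leading coefficient is in column `i`. -/
abbrev Piv (v : Fin n → Bool) : Type := {i : Fin n // v i = true}

/-- The positions of the zeros of a binary vector `v`: the columns that remain when the pivot
columns are removed. -/
abbrev NonPiv (v : Fin n → Bool) : Type := {j : Fin n // v j = false}

/-- The Ferrers diagram of the identifying vector `v`. The row of the pivot `i` has dots exactly
in the non-pivot columns to the right of `i`. -/
def ferrersDiagram (v : Fin n → Bool) : Set (Piv v × NonPiv v) :=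
  {x | x.1.1 < x.2.1}

/-- The number of dots of `D` that are in neither the first `i` rows nor the rightmost `r`
columns. -/
noncomputable def dotsOutside {v : Fin n → Bool} (D : Set (Piv v × NonPiv v)) (i r : ℕ) : ℕ :=
  Set.ncard {x ∈ D | i ≤ Set.ncard {i' : Piv v | i' < x.1} ∧
    r ≤ Set.ncard {j' : NonPiv v | x.2 < j'}}

/-- The upper bound `min_{0 ≤ i ≤ d - 1} w_i` for the dimension of a Ferrers diagram rank-metric
code with diagram `D` and minimum rank distance `d ≥ 1`, where `w_i` is the number of dots in
neither the first `i` rows nor the rightmost `d - 1 - i` columns. -/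
noncomputable def ferrersBound {v : Fin n → Bool} (D : Set (Piv v × NonPiv v)) (d : ℕ) : ℕ :=
  sInf {w : ℕ | ∃ i < d, w = dotsOutside D i (d - 1 - i)}

variable {F : Type*} [Field F]

/-- `K` is a (linear) Ferrers diagram maximum rank distance code with diagram `D` and rank
distance `d`: its matrices vanish outside `D`, distinct ones have rank distance at least `d`,
and its dimension attains the upper bound. -/
def IsFDMRD {v : Fin n → Bool} (D : Set (Piv v × NonPiv v)) (d : ℕ)
    (K : Submodule F (Matrix (Piv v) (NonPiv v) F)) : Prop :=
  (∀ A ∈ K, ∀ i j, (i, j) ∉ D → A i j = 0) ∧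
    (∀ A ∈ K, ∀ B ∈ K, A ≠ B → d ≤ (A - B).rank) ∧
    Module.finrank F K = ferrersBound D d

/-- The matrix with the unit vectors in the pivot columns and the columns of `A` in the remaining
ones. If `A` vanishes outside the Ferrers diagram of `v` this is the reduced row echelon form
with identifying vector `v` and Ferrers tableaux form given by `A`. -/
def reMatrix (v : Fin n → Bool) (A : Matrix (Piv v) (NonPiv v) F) : Matrix (Piv v) (Fin n) F :=
  fun i j => if h : v j = false then A i ⟨j, h⟩ else if i.1 = j then 1 else 0

/-- The lifted subspace: the row space of `reMatrix v A`. -/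
def liftSubspace (v : Fin n → Bool) (A : Matrix (Piv v) (NonPiv v) F) :
    Submodule F (Fin n → F) :=
  Submodule.span F (Set.range fun i => reMatrix v A i)

/-- The pending dot (as a set with at most one element) for rank distance `d`: the leftmost dot
of the first row of the Ferrers diagram of `v`, provided that its removal has no impact on the
size of a maximum rank distance code with that diagram. -/
def pendingDot (v : Fin n → Bool) (d : ℕ) : Set (Piv v × NonPiv v) :=
  {x | x ∈ ferrersDiagram v ∧ (∀ i : Piv v, x.1 ≤ i) ∧
    (∀ j : NonPiv v, (x.1, j) ∈ ferrersDiagram v → x.2 ≤ j) ∧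
    ferrersBound (ferrersDiagram v \ {x}) d = ferrersBound (ferrersDiagram v) d}

open scoped Classical in
/-- The matrix with entry `a` at the pending dot and `0` elsewhere. -/
noncomputable def pendingMatrix (v : Fin n → Bool) (d : ℕ) (a : F) :
    Matrix (Piv v) (NonPiv v) F :=
  fun i j => if (i, j) ∈ pendingDot v d then a else 0

end Ferrers

/-- The weight-2 vector of the edge `{a, b}` of the complete graph; the node with label `a` is the
coordinate with (1-based) number `a`. -/
def edgeVec (m a b : ℕ) : Fin m → Bool :=
  fun j => decide (j.1 + 1 = a ∨ j.1 + 1 = b)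

/-- The class `P_i` of the circle construction, as a set of weight-2 vectors of length `m`.
If `m` is odd, the nodes `1, …, m` lie on a circle and `P_i` consists of the parallel edges
`{a, b}` that are mirror symmetric with respect to the node `i`, which is not covered. If `m` is
even, the nodes `1, …, m - 1` lie on a circle around the node `m`, and `P_i` consists of the edge
`{i, m}` and of all edges `{a, b}` orthogonal to it. Labels of nodes on the circle are read
cyclically in the index `i`, so that `P_m = P_1` for even `m`. -/
def oneFactor (m i : ℕ) : Set (Fin m → Bool) :=
  if Even m then
    {v | (∃ a ∈ Finset.Icc 1 (m - 1), ∃ b ∈ Finset.Icc 1 (m - 1),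
            a ≠ b ∧ a + b ≡ 2 * i [MOD m - 1] ∧ v = edgeVec m a b) ∨
          ∃ a ∈ Finset.Icc 1 (m - 1), a ≡ i [MOD m - 1] ∧ v = edgeVec m a m}
  else
    {v | ∃ a ∈ Finset.Icc 1 m, ∃ b ∈ Finset.Icc 1 m,
            a ≠ b ∧ a + b ≡ 2 * i [MOD m] ∧ v = edgeVec m a b}

namespace ConstructionC4

/-- The identifying vector `(1111 || 0…0)`. -/
def A0 (n : ℕ) : Set (Fin n → Bool) :=
  {concatVec ![true, true, true, true] (fun _ : Fin (n - 4) => false)}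

/-- The vectors `(1100 || v)`, `(0011 || v)` with `v ∈ P_{⌈n'/2⌉ + 1}`, where `n' = n - 4`. -/
def A1 (n : ℕ) : Set (Fin n → Bool) :=
  {u | ∃ p ∈ ({![true, true, false, false], ![false, false, true, true]} : Set (Fin 4 → Bool)),
    ∃ y ∈ oneFactor (n - 4) ((n - 4 + 1) / 2 + 1), u = concatVec p y}

/-- The vectors `(1001 || v)`, `(0110 || v)` with `v ∈ P_2`. -/
def A2 (n : ℕ) : Set (Fin n → Bool) :=
  {u | ∃ p ∈ ({![true, false, false, true], ![false, true, true, false]} : Set (Fin 4 → Bool)),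
    ∃ y ∈ oneFactor (n - 4) 2, u = concatVec p y}

/-- The indices of the classes used in `A3`: `⌈n'/2⌉ + i` for
`2 ≤ i ≤ min (⌈q/2⌉ + 1) ⌊n'/2⌋`, and `i` for `3 ≤ i ≤ min (⌊q/2⌋ + 2) ⌈n'/2⌉`. -/
def classIndices (q n' : ℕ) : Set ℕ :=
  {j | (∃ i, 2 ≤ i ∧ i ≤ min ((q + 1) / 2 + 1) (n' / 2) ∧ j = (n' + 1) / 2 + i) ∨
    (3 ≤ j ∧ j ≤ min (q / 2 + 2) ((n' + 1) / 2))}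

/-- The prefixes `1010` and `0101`. -/
def prefixes3 : Set (Fin 4 → Bool) :=
  {![true, false, true, false], ![false, true, false, true]}

/-- The vectors `(1010 || v)`, `(0101 || v)` with `v` in one of the classes `P_j`, for the selected
indices `j`. -/
def A3 (q n : ℕ) : Set (Fin n → Bool) :=
  {u | ∃ p ∈ prefixes3, ∃ j ∈ classIndices q (n - 4), ∃ y ∈ oneFactor (n - 4) j,
    u = concatVec p y}

/-- `C` is a code obtained by Construction C-4 from the shorter code `S`, for some choice of the
FDMRD codes `K v` and of the values `a p j` of the pending dots. For identifying vectors in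
`A3` the pending dot is not used by the FDMRD code but filled with an element of `F` that
depends on the class of the suffix, different classes getting different elements. -/
def IsCode {F : Type*} [Field F] [Fintype F] (n : ℕ)
    (S : Set (Submodule F (Fin (n - 4) → F))) (C : Set (Submodule F (Fin n → F))) : Prop :=
  ∃ (K : ∀ v : Fin n → Bool, Submodule F (Matrix (Piv v) (NonPiv v) F))
    (a : (Fin 4 → Bool) → ℕ → F),
    (∀ v ∈ A0 n ∪ A1 n ∪ A2 n, IsFDMRD (ferrersDiagram v) 2 (K v)) ∧
    (∀ v ∈ A3 (Fintype.card F) n, IsFDMRD (ferrersDiagram v \ pendingDot v 2) 2 (K v)) ∧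
    (∀ p ∈ prefixes3, Set.InjOn (a p) (classIndices (Fintype.card F) (n - 4))) ∧
    C = {X | ∃ v ∈ A0 n ∪ A1 n ∪ A2 n, ∃ A ∈ K v, X = liftSubspace v A} ∪
      {X | ∃ p ∈ prefixes3, ∃ j ∈ classIndices (Fintype.card F) (n - 4),
        ∃ y ∈ oneFactor (n - 4) j, ∃ A ∈ K (concatVec p y),
          X = liftSubspace (concatVec p y) (A + pendingMatrix (concatVec p y) 2 (a p j))} ∪
      {X | ∃ Y ∈ S, X = Y.map (padZeros F 4 n)}

end ConstructionC4

/-!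
The code is a union of layers, one for each identifying vector, and everything follows from three
facts about lifted subspaces.

*Distances.* A subspace `X` lifted from `v` is a graph over its pivot coordinates
(`mem_liftSubspace_iff`), and the leading position of each of its nonzero vectors is a one of `v`.
Hence `X ∩ Y`, with `Y` lifted from `w`, embeds into the coordinates at the common ones of `v` and
`w` (`finrank_inf_liftSubspace_le`), while for `v = w` the dimension of `X ∩ Y` is at most
`4 - rank (A - B)`. Since all subspaces have dimension four, subspace distance at least four
means that distinct ones meet in dimension at most two. Two identifying vectors of the construction
have at most two common ones, because classes are disjoint perfect or nearly perfect matchings and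
each class is used with one pair of complementary prefixes only. The exception is formed by edges
with a common node from different classes behind the same prefix `1010` or `0101`. There the
coordinate behind the first pivot is the pending value times the coordinate at the first pivot, so
different pending values force the latter to vanish on `X ∩ Y`, and the first pivot need not be
counted (`IsChoice.finrank_inf_le_two`). A padded subspace meets a lifted one in dimension at most
two, because two pivots of the latter are in the prefix. The distance four is attained, since the
code for `1111` is so large that it contains a nonzero matrix with two zero rows.

*Rank-metric codes.* For rank distance two the bound is the number of dots outside the first row as
soon as the first row has at least as many dots as there are rows (`ferrersBound_two`). It is
attained (`exists_isFDMRD`): if the first row has `m` dots, read the rows as elements of the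
extension field of degree `m` and let the code be the kernel of one parity check with linearly
independent coefficients; a matrix of rank one cannot satisfy it. The number of dots depends
only on the sum of the positions of the last three ones (`IsOnes.ncard_other_rows_add`).

*Cardinality.* The bound on intersections shows that all lifted subspaces are different
(`IsChoice.ncard_unionCode`). The layers of a prefix contribute powers of `q` whose exponents
depend on an edge `{a, b}` only through `a + b`. On the circle, the sums of the edges of a class
take two values, which differ by the length of the circle; counting the edges with given sum
(`sum_classEdges`) gives the summands of the formula.
-/

/-! ### Lifted subspaces -/

section Lift

variable {F : Type*} [Field F] {n : ℕ}

theorem reMatrix_piv (v : Fin n → Bool) (A : Matrix (Piv v) (NonPiv v) F) (i k : Piv v) :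
    reMatrix v A i k = if i = k then 1 else 0 := by
  simp [reMatrix, k.2, Subtype.ext_iff]

theorem reMatrix_nonPiv (v : Fin n → Bool) (A : Matrix (Piv v) (NonPiv v) F) (i : Piv v)
    (j : NonPiv v) : reMatrix v A i j = A i j := by
  simp [reMatrix, j.2]

theorem sum_smul_reMatrix_piv (v : Fin n → Bool) (A : Matrix (Piv v) (NonPiv v) F)
    (c : Piv v → F) (k : Piv v) : (∑ i, c i • reMatrix v A i) k = c k := by
  simp [Finset.sum_apply, reMatrix_piv]

theorem sum_smul_reMatrix_nonPiv (v : Fin n → Bool) (A : Matrix (Piv v) (NonPiv v) F)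
    (c : Piv v → F) (j : NonPiv v) : (∑ i, c i • reMatrix v A i) j = ∑ i, c i * A i j := by
  simp [Finset.sum_apply, reMatrix_nonPiv]

/-- A lifted subspace is a graph: the pivot coordinates of its members are free, and the
matrix expresses the other coordinates by them. -/
theorem mem_liftSubspace_iff (v : Fin n → Bool) (A : Matrix (Piv v) (NonPiv v) F)
    (x : Fin n → F) :
    x ∈ liftSubspace v A ↔ ∀ j : NonPiv v, x j = ∑ i : Piv v, x i * A i j := by
  rw [liftSubspace, Submodule.mem_span_range_iff_exists_fun]
  constructor
  · rintro ⟨c, rfl⟩ j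
    rw [sum_smul_reMatrix_nonPiv]
    exact Finset.sum_congr rfl fun i _ => by rw [sum_smul_reMatrix_piv]
  · intro h
    refine ⟨fun i => x i, funext fun k => ?_⟩
    cases hk : v k
    · exact (sum_smul_reMatrix_nonPiv v A _ ⟨k, hk⟩).trans (h ⟨k, hk⟩).symm
    · exact sum_smul_reMatrix_piv v A _ ⟨k, hk⟩

theorem eq_zero_of_mem_liftSubspace {v : Fin n → Bool} {A : Matrix (Piv v) (NonPiv v) F}
    {x : Fin n → F} (hx : x ∈ liftSubspace v A) (h : ∀ i : Piv v, x i = 0) : x = 0 := by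
  funext k
  cases hk : v k
  · simpa [h] using (mem_liftSubspace_iff v A x).1 hx ⟨k, hk⟩
  · exact h ⟨k, hk⟩

theorem linearIndependent_reMatrix (v : Fin n → Bool) (A : Matrix (Piv v) (NonPiv v) F) :
    LinearIndependent F fun i => reMatrix v A i := by
  rw [Fintype.linearIndependent_iff]
  intro g hg i
  rw [← sum_smul_reMatrix_piv v A g i, hg]
  rfl

theorem finrank_liftSubspace (v : Fin n → Bool) (A : Matrix (Piv v) (NonPiv v) F) :
    Module.finrank F (liftSubspace v A) = Fintype.card (Piv v) :=
  finrank_span_eq_card (linearIndependent_reMatrix v A)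

theorem reMatrix_mem_liftSubspace (v : Fin n → Bool) (A : Matrix (Piv v) (NonPiv v) F)
    (i : Piv v) : reMatrix v A i ∈ liftSubspace v A :=
  Submodule.subset_span ⟨i, rfl⟩

/-- The leading position of a vector of a lifted subspace is a pivot position. -/
theorem eq_true_of_leading {v : Fin n → Bool} {A : Matrix (Piv v) (NonPiv v) F}
    (hA : ∀ i j, (i, j) ∉ ferrersDiagram v → A i j = 0) {x : Fin n → F}
    (hx : x ∈ liftSubspace v A) {p : Fin n} (hp : x p ≠ 0) (hlt : ∀ k < p, x k = 0) :
    v p = true := by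
  by_contra hv
  have hv : v p = false := by simpa using hv
  refine hp (((mem_liftSubspace_iff v A x).1 hx ⟨p, hv⟩).trans
    (Finset.sum_eq_zero fun i _ => ?_))
  by_cases hi : i.1 < p
  · rw [hlt _ hi, zero_mul]
  · rw [hA i ⟨p, hv⟩ (by simpa [ferrersDiagram] using hi), mul_zero]

theorem exists_leading {x : Fin n → F} (hx : x ≠ 0) : ∃ p, x p ≠ 0 ∧ ∀ k < p, x k = 0 := by
  obtain ⟨p, hp, hmin⟩ := WellFounded.has_min (wellFounded_lt (α := Fin n)) {p | x p ≠ 0}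
    (Function.ne_iff.1 hx)
  exact ⟨p, hp, fun k hk => by_contra fun h => hmin k h hk⟩

theorem finrank_le_card_of_forall_eq_zero (W : Submodule F (Fin n → F)) (T : Finset (Fin n))
    (h : ∀ x ∈ W, (∀ p ∈ T, x p = 0) → x = 0) : Module.finrank F W ≤ T.card := by
  have hinj : Function.Injective
      ((LinearMap.funLeft F F (Subtype.val : T → Fin n)).comp W.subtype) := by
    rw [← LinearMap.ker_eq_bot, LinearMap.ker_eq_bot']
    intro x hx
    exact Subtype.ext (h x x.2 fun p hp => congrFun hx ⟨p, hp⟩)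
  simpa using LinearMap.finrank_le_finrank_of_injective hinj

/-- The intersection of two lifted subspaces embeds into the coordinates at the common pivots,
because the leading position of each of its vectors is a common pivot. Common pivots at which the
whole intersection vanishes need not be counted. -/
theorem finrank_inf_liftSubspace_le {v w : Fin n → Bool} {A : Matrix (Piv v) (NonPiv v) F}
    {B : Matrix (Piv w) (NonPiv w) F} (hA : ∀ i j, (i, j) ∉ ferrersDiagram v → A i j = 0)
    (hB : ∀ i j, (i, j) ∉ ferrersDiagram w → B i j = 0) (T : Finset (Fin n))
    (hT : ∀ p, v p = true → w p = true → p ∉ T →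
      ∀ x ∈ liftSubspace v A ⊓ liftSubspace w B, x p = 0) :
    Module.finrank F (liftSubspace v A ⊓ liftSubspace w B : Submodule F (Fin n → F)) ≤
      T.card := by
  refine finrank_le_card_of_forall_eq_zero _ T fun x hx h => by_contra fun hne => ?_
  obtain ⟨p, hp, hlt⟩ := exists_leading hne
  by_cases hpT : p ∈ T
  · exact hp (h p hpT)
  · exact hp (hT p (eq_true_of_leading hA hx.1 hp hlt) (eq_true_of_leading hB hx.2 hp hlt)
      hpT x hx)

theorem finrank_inf_liftSubspace_add_rank_le (v : Fin n → Bool)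
    (A B : Matrix (Piv v) (NonPiv v) F) :
    Module.finrank F (liftSubspace v A ⊓ liftSubspace v B : Submodule F (Fin n → F)) +
      (A - B).rank ≤ Fintype.card (Piv v) := by
  set W := (liftSubspace v A ⊓ liftSubspace v B : Submodule F (Fin n → F)) with hW
  have hker : ∀ x : W, LinearMap.funLeft F F (Subtype.val : Piv v → Fin n) x.1 ∈
      LinearMap.ker (A - B).transpose.mulVecLin := by
    intro x
    rw [LinearMap.mem_ker]
    funext j
    have h1 := (mem_liftSubspace_iff v A x.1).1 x.2.1 j
    have h2 := (mem_liftSubspace_iff v B x.1).1 x.2.2 j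
    simp only [Matrix.mulVecLin_apply, Matrix.mulVec, dotProduct, Matrix.transpose_apply,
      Matrix.sub_apply, LinearMap.funLeft_apply, Pi.zero_apply, sub_mul, Finset.sum_sub_distrib]
    rw [sub_eq_zero]
    simpa [mul_comm] using h1.symm.trans h2
  have hinj : Function.Injective (((LinearMap.funLeft F F
      (Subtype.val : Piv v → Fin n)).comp W.subtype).codRestrict _ hker) := by
    rw [← LinearMap.ker_eq_bot, LinearMap.ker_eq_bot']
    intro x hx
    exact Subtype.ext (eq_zero_of_mem_liftSubspace x.2.1
      fun i => congrFun (congrArg Subtype.val hx) i)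
  have h1 := LinearMap.finrank_le_finrank_of_injective hinj
  have h2 := LinearMap.finrank_range_add_finrank_ker (A - B).transpose.mulVecLin
  rw [Module.finrank_fintype_fun_eq_card] at h2
  rw [← Matrix.rank_transpose (A - B), Matrix.rank]
  exact (Nat.add_le_add_right h1 _).trans_eq ((Nat.add_comm _ _).trans h2)

/-- If column `j` of `A` is zero outside row `i`, then the entry of `A` there is the ratio of two
coordinates on the lifted subspace. -/
theorem apply_eq_mul_of_mem_liftSubspace {v : Fin n → Bool} {A : Matrix (Piv v) (NonPiv v) F}
    {x : Fin n → F} (hx : x ∈ liftSubspace v A) {i : Piv v} {j : NonPiv v}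
    (h : ∀ i', i' ≠ i → A i' j = 0) : x j = x i * A i j := by
  rw [(mem_liftSubspace_iff v A x).1 hx j]
  exact Finset.sum_eq_single i (fun i' _ hi' => by rw [h i' hi', mul_zero]) (by simp)

theorem four_le_subspaceDist {X Y : Submodule F (Fin n → F)} (hX : Module.finrank F X = 4)
    (hY : Module.finrank F Y = 4)
    (h : Module.finrank F (X ⊓ Y : Submodule F (Fin n → F)) ≤ 2) : 4 ≤ subspaceDist X Y := by
  unfold subspaceDist
  omega

end Lift

/-! ### Ferrers diagram codes with rank distance two -/

section FDMRD

variable {n : ℕ} {v : Fin n → Bool}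

theorem dotsOutside_one_zero (D : Set (Piv v × NonPiv v)) {i₀ : Piv v} (h₀ : ∀ i, i₀ ≤ i) :
    dotsOutside D 1 0 = {x ∈ D | x.1 ≠ i₀}.ncard := by
  have h : ∀ x : Piv v × NonPiv v, 1 ≤ {i' : Piv v | i' < x.1}.ncard ↔ x.1 ≠ i₀ := by
    intro x
    rw [Nat.one_le_iff_ne_zero, ← Nat.pos_iff_ne_zero, Set.ncard_pos]
    constructor
    · rintro ⟨i, hi⟩ rfl
      exact absurd (h₀ i) (not_le.2 hi)
    · exact fun hne => ⟨i₀, lt_of_le_of_ne (h₀ _) hne.symm⟩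
  simp [dotsOutside, h]

theorem ncard_row_add_ncard (D : Set (Piv v × NonPiv v)) (i₀ : Piv v) :
    {x ∈ D | x.1 = i₀}.ncard + {x ∈ D | x.1 ≠ i₀}.ncard = D.ncard := by
  rw [← Set.ncard_union_eq]
  · congr 1
    ext x
    by_cases h : x.1 = i₀ <;> simp [h]
  · exact Set.disjoint_left.2 fun x hx hy => hy.2 hx.2

theorem ncard_le_dotsOutside_zero_one (D : Set (Piv v × NonPiv v)) :
    D.ncard ≤ dotsOutside D 0 1 + Fintype.card (Piv v) := by
  have hU : D ⊆ {x ∈ D | 0 ≤ {i' : Piv v | i' < x.1}.ncard ∧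
      1 ≤ {j' : NonPiv v | x.2 < j'}.ncard} ∪ {x | ∀ j, j ≤ x.2} := by
    intro x hx
    by_cases h : ∀ j, j ≤ x.2
    · exact Or.inr h
    · push Not at h
      exact Or.inl ⟨hx, Nat.zero_le _, Nat.succ_le_of_lt ((Set.ncard_pos (Set.toFinite _)).2 h)⟩
  have hlast : {x : Piv v × NonPiv v | ∀ j, j ≤ x.2}.ncard ≤ Fintype.card (Piv v) := by
    rw [← Nat.card_eq_fintype_card, ← Set.ncard_univ]
    exact Set.ncard_le_ncard_of_injOn Prod.fst (fun _ _ => Set.mem_univ _)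
      fun x hx y hy hxy => Prod.ext hxy (le_antisymm (hy x.2) (hx y.2))
  exact (Set.ncard_le_ncard hU).trans ((Set.ncard_union_le _ _).trans
    (Nat.add_le_add_left hlast _))

/-- If the first row of `D` has at least as many dots as there are rows, the minimum in the bound
is attained by the deletion of the first row, since the last column has no more dots. -/
theorem ferrersBound_two (D : Set (Piv v × NonPiv v)) {i₀ : Piv v} (h₀ : ∀ i, i₀ ≤ i)
    (hrow : Fintype.card (Piv v) ≤ {x ∈ D | x.1 = i₀}.ncard) :
    ferrersBound D 2 = {x ∈ D | x.1 ≠ i₀}.ncard := by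
  have h1 := dotsOutside_one_zero D h₀
  have h2 := ncard_row_add_ncard D i₀
  have h3 := ncard_le_dotsOutside_zero_one D
  rw [← h1]
  apply le_antisymm
  · exact Nat.sInf_le ⟨1, by norm_num, rfl⟩
  · refine le_csInf ⟨_, 1, by norm_num, rfl⟩ ?_
    rintro w ⟨i, hi, rfl⟩
    interval_cases i
    · show _ ≤ dotsOutside D 0 1
      omega
    · exact le_rfl

variable {F : Type*} [Field F]

/-- The rows of a nonzero matrix of rank less than two are multiples of one of them. -/
theorem exists_rows_proportional {ι κ : Type*} [Fintype ι] [Fintype κ] {A : Matrix ι κ F}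
    (hA : A ≠ 0) (hr : A.rank < 2) :
    ∃ i, A i ≠ 0 ∧ ∃ u : ι → F, u i = 1 ∧ ∀ k, A k = u k • A i := by
  classical
  obtain ⟨i, hi⟩ := Function.ne_iff.1 hA
  have hmem : ∀ k, A k ∈ Submodule.span F (Set.range A) := fun k => Submodule.subset_span ⟨k, rfl⟩
  have hle : Module.finrank F (Submodule.span F (Set.range A)) ≤ 1 := by
    have h := Matrix.rank_eq_finrank_span_row A
    have h' : Module.finrank F (Submodule.span F (Set.range A)) = A.rank := h.symm
    omega
  have hspan : Module.finrank F (Submodule.span F (Set.range A)) = 1 := by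
    refine le_antisymm hle (Nat.one_le_iff_ne_zero.2 fun h => hi ?_)
    rw [Submodule.finrank_eq_zero] at h
    exact (Submodule.mem_bot F).1 (h ▸ hmem i)
  have hprop := (finrank_eq_one_iff_of_nonzero' (⟨A i, hmem i⟩ : Submodule.span F (Set.range A))
    (fun h => hi (congrArg Subtype.val h))).1 hspan
  refine ⟨i, hi, fun k => if k = i then 1 else (hprop ⟨A k, hmem k⟩).choose, by simp, fun k => ?_⟩
  by_cases hk : k = i
  · simp [hk]
  · simpa [hk] using (congrArg Subtype.val (hprop ⟨A k, hmem k⟩).choose_spec).symm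

/-- The extension by zero of a filling of the dots of `D`. -/
def fillDots (D : Set (Piv v × NonPiv v)) [DecidablePred (· ∈ D)] :
    (D → F) →ₗ[F] Matrix (Piv v) (NonPiv v) F where
  toFun f := Matrix.of fun i j => if h : (i, j) ∈ D then f ⟨(i, j), h⟩ else 0
  map_add' f g := by
    ext i j
    by_cases h : (i, j) ∈ D <;> simp [h]
  map_smul' c f := by
    ext i j
    by_cases h : (i, j) ∈ D <;> simp [h]

theorem fillDots_apply (D : Set (Piv v × NonPiv v)) [DecidablePred (· ∈ D)] (f : D → F)
    (i : Piv v) (j : NonPiv v) :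
    fillDots D f i j = if h : (i, j) ∈ D then f ⟨(i, j), h⟩ else 0 := rfl

theorem fillDots_injective (D : Set (Piv v × NonPiv v)) [DecidablePred (· ∈ D)] :
    Function.Injective (fillDots (F := F) D) := by
  intro f g hfg
  funext x
  have := congrFun (congrFun hfg x.1.1) x.1.2
  simpa [fillDots_apply] using this

theorem exists_fieldExtension (F : Type*) [Field F] [Fintype F] {m : ℕ} (hm : m ≠ 0) :
    ∃ (L : Type) (_ : Field L) (_ : Algebra F L), Module.finrank F L = m := by
  obtain ⟨p, hp⟩ := CharP.exists F
  have : Fact p.Prime := ⟨CharP.char_is_prime F p⟩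
  have : NeZero m := ⟨hm⟩
  exact ⟨FiniteField.Extension F p m, inferInstance, inferInstance,
    FiniteField.finrank_extension F p m⟩

/-- A diagram all of whose columns meet the first row supports an optimal code with rank distance
two as soon as that row has at least as many dots as there are rows. -/
theorem exists_isFDMRD [Fintype F] (D : Set (Piv v × NonPiv v)) {i₀ : Piv v}
    (h₀ : ∀ i, i₀ ≤ i) (hrow : Fintype.card (Piv v) ≤ {x ∈ D | x.1 = i₀}.ncard)
    (hcol : ∀ i j, (i, j) ∈ D → (i₀, j) ∈ D) :
    ∃ K : Submodule F (Matrix (Piv v) (NonPiv v) F), IsFDMRD D 2 K := by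
  classical
  -- The columns met by the first row; rows are read as elements of a field of that degree.
  let J := {j : NonPiv v // (i₀, j) ∈ D}
  have hJ : Fintype.card J = {x ∈ D | x.1 = i₀}.ncard := by
    rw [← Nat.card_eq_fintype_card]
    have : Set.BijOn (Prod.mk i₀) {j : NonPiv v | (i₀, j) ∈ D} {x ∈ D | x.1 = i₀} := by
      refine ⟨fun j hj => ⟨hj, rfl⟩, fun a _ b _ h => (Prod.ext_iff.1 h).2, ?_⟩
      rintro ⟨i, j⟩ ⟨hx, rfl⟩
      exact ⟨j, hx, rfl⟩
    rw [← this.image_eq, this.injOn.ncard_image, Set.ncard]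
    rfl
  have : Nonempty (Piv v) := ⟨i₀⟩
  have hpos : Fintype.card J ≠ 0 := by
    have := Fintype.card_pos (α := Piv v)
    omega
  obtain ⟨L, _, _, hL⟩ := exists_fieldExtension F hpos
  have : FiniteDimensional F L := FiniteDimensional.of_finrank_pos (by omega)
  let φ : (J → F) ≃ₗ[F] L := LinearEquiv.ofFinrankEq _ _ (by simp [hL])
  obtain ⟨β, hβ⟩ : ∃ β : Piv v → L, LinearIndependent F β := by
    let b := Module.finBasis F L
    let e : Piv v ↪ Fin (Module.finrank F L) :=
      (Fintype.equivFin _).toEmbedding.trans (Fin.castLEEmb (by omega))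
    exact ⟨b ∘ e, b.linearIndependent.comp e e.injective⟩
  -- The parity check: the rows, weighted with independent field elements, add up to zero.
  let χ : Matrix (Piv v) (NonPiv v) F →ₗ[F] L :=
    ∑ i, (LinearMap.mulLeft F (β i)).comp (φ.toLinearMap.comp
      ((LinearMap.funLeft F F (Subtype.val : J → NonPiv v)).comp (LinearMap.proj i)))
  have hχ : ∀ A, χ A = ∑ i, β i * φ (fun j : J => A i j) := by
    intro A
    simp only [χ, LinearMap.sum_apply]
    rfl
  let ψ := χ.comp (fillDots (F := F) D)
  have hsurj : Function.Surjective ψ := by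
    intro y
    refine ⟨fun x => if h : x.1.1 = i₀ then φ.symm ((β i₀)⁻¹ * y) ⟨x.1.2, h ▸ x.2⟩ else 0, ?_⟩
    show χ _ = y
    rw [hχ, Finset.sum_eq_single i₀]
    · have : (fun j : J => fillDots (F := F) D (fun x => if h : x.1.1 = i₀ then
          φ.symm ((β i₀)⁻¹ * y) ⟨x.1.2, h ▸ x.2⟩ else 0) i₀ j) = φ.symm ((β i₀)⁻¹ * y) := by
        funext j
        simp [fillDots_apply, j.2]
      rw [this, φ.apply_symm_apply, mul_inv_cancel_left₀ (hβ.ne_zero i₀)]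
    · intro i _ hi
      have : (fun j : J => fillDots (F := F) D (fun x => if h : x.1.1 = i₀ then
          φ.symm ((β i₀)⁻¹ * y) ⟨x.1.2, h ▸ x.2⟩ else 0) i j) = 0 := by
        funext j
        simp [fillDots_apply, hi]
      rw [this, map_zero, mul_zero]
    · simp
  refine ⟨(LinearMap.ker ψ).map (fillDots D), ?_, ?_, ?_⟩
  · rintro _ ⟨f, _, rfl⟩ i j hij
    simp [fillDots_apply, hij]
  · intro A hA B hB hAB
    by_contra! hlt
    have hsub := Submodule.sub_mem _ hA hB
    obtain ⟨f, hf, hfe⟩ := hsub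
    obtain ⟨i, hi, u, hui, hu⟩ := exists_rows_proportional (sub_ne_zero.2 hAB) hlt
    have hker : χ (A - B) = 0 := by
      rw [← hfe]
      exact hf
    have hprod : (∑ k, u k • β k) * φ (fun j : J => (A - B) i j) = 0 := by
      rw [← hker, hχ, Finset.sum_mul]
      refine Finset.sum_congr rfl fun k _ => ?_
      have : (fun j : J => (A - B) k j) = u k • fun j : J => (A - B) i j := by
        funext j
        exact congrFun (hu k) j
      rw [this, map_smul, smul_mul_assoc, mul_smul_comm]
    rcases mul_eq_zero.1 hprod with h | h
    · have := Fintype.linearIndependent_iff.1 hβ u h i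
      rw [hui] at this
      exact one_ne_zero this
    · rw [LinearEquiv.map_eq_zero_iff] at h
      refine hi (funext fun j => ?_)
      by_cases hj : (i₀, j) ∈ D
      · exact congrFun h ⟨j, hj⟩
      · rw [← hfe]
        have : (i, j) ∉ D := fun h => hj (hcol i j h)
        simp [fillDots_apply, this]
  · rw [ferrersBound_two D h₀ hrow, ← LinearEquiv.finrank_eq
      (Submodule.equivMapOfInjective _ (fillDots_injective D) _)]
    have h1 := LinearMap.finrank_range_add_finrank_ker ψ
    rw [LinearMap.range_eq_top.2 hsurj, finrank_top, hL, Module.finrank_fintype_fun_eq_card, hJ,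
      ← Nat.card_eq_fintype_card] at h1
    have h2 := ncard_row_add_ncard D i₀
    have h3 : Nat.card D = D.ncard := rfl
    omega

end FDMRD

/-! ### Ferrers diagrams of identifying vectors of weight four -/

section WeightFour

theorem ncard_eq_sum_ncard_fiber {α β : Type*} [Fintype α] [Finite β] (E : Set (α × β)) :
    E.ncard = ∑ a, {b | (a, b) ∈ E}.ncard := by
  classical
  have := Fintype.ofFinite β
  have h : ∀ a, {b | (a, b) ∈ E}.ncard = ∑ b, if (a, b) ∈ E then 1 else 0 := by
    intro a
    rw [← Finset.card_filter, Set.ncard_eq_toFinset_card']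
    congr 1
    ext b
    simp
  simp_rw [h]
  rw [← Fintype.sum_prod_type', ← Finset.card_filter, Set.ncard_eq_toFinset_card']
  congr 1
  ext b
  simp

variable {n : ℕ} {v : Fin n → Bool} {t : Fin 4 → Fin n}

/-- The positions `t 0 < t 1 < t 2 < t 3` are the ones of `v`. -/
structure IsOnes (v : Fin n → Bool) (t : Fin 4 → Fin n) : Prop where
  strictMono : StrictMono t
  eq_true_iff : ∀ i, v i = true ↔ ∃ k, t k = i

namespace IsOnes

/-- The pivot with number `k`. -/
def piv (h : IsOnes v t) (k : Fin 4) : Piv v := ⟨t k, (h.eq_true_iff _).2 ⟨k, rfl⟩⟩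

theorem piv_bijective (h : IsOnes v t) : Function.Bijective h.piv := by
  constructor
  · intro k l hkl
    exact h.strictMono.injective (congrArg Subtype.val hkl)
  · intro i
    obtain ⟨k, hk⟩ := (h.eq_true_iff i.1).1 i.2
    exact ⟨k, Subtype.ext hk⟩

theorem card_piv (h : IsOnes v t) : Fintype.card (Piv v) = 4 := by
  rw [← Fintype.card_of_bijective h.piv_bijective, Fintype.card_fin]

theorem piv_zero_le (h : IsOnes v t) (i : Piv v) : h.piv 0 ≤ i := by
  obtain ⟨k, rfl⟩ := h.piv_bijective.2 i
  exact h.strictMono.monotone (Fin.zero_le k)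

theorem piv_inj (h : IsOnes v t) {k l : Fin 4} : h.piv k = h.piv l ↔ k = l :=
  h.piv_bijective.1.eq_iff

/-- The `k`-th row has one dot for each position behind its pivot, apart from the `3 - k` later
pivots. -/
theorem ncard_row_add (h : IsOnes v t) (k : Fin 4) :
    {j : NonPiv v | (h.piv k, j) ∈ ferrersDiagram v}.ncard + (3 - k) + t k + 1 = n := by
  have h1 : {j : NonPiv v | (h.piv k, j) ∈ ferrersDiagram v}.ncard =
      ((Finset.Ioi (t k)).filter fun j => ¬ v j = true).card := by
    rw [← Set.ncard_coe_finset, ← Set.ncard_image_of_injective _ Subtype.val_injective]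
    congr 1
    ext j
    simp [ferrersDiagram, piv, and_comm]
  have h2 : ((Finset.Ioi (t k)).filter fun j => v j = true) =
      (Finset.Ioi k).map ⟨t, h.strictMono.injective⟩ := by
    ext j
    simp only [Finset.mem_filter, Finset.mem_Ioi, Finset.mem_map, Function.Embedding.coeFn_mk,
      h.eq_true_iff]
    constructor
    · rintro ⟨hlt, l, rfl⟩
      exact ⟨l, h.strictMono.lt_iff_lt.1 hlt, rfl⟩
    · rintro ⟨l, hl, rfl⟩
      exact ⟨h.strictMono hl, l, rfl⟩
  have h3 := Finset.card_filter_add_card_filter_not (s := Finset.Ioi (t k)) (fun j => v j = true)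
  rw [h2, Finset.card_map, Fin.card_Ioi, Fin.card_Ioi] at h3
  have := (t k).isLt
  omega

theorem ncard_row (D : Set (Piv v × NonPiv v)) (i : Piv v) :
    {x ∈ D | x.1 = i}.ncard = {j : NonPiv v | (i, j) ∈ D}.ncard := by
  rw [← Set.ncard_image_of_injective {j : NonPiv v | (i, j) ∈ D} (Prod.mk_right_injective i)]
  refine congrArg Set.ncard ?_
  ext ⟨a, j⟩
  simp only [Set.mem_ofPred_eq, Set.mem_image, Prod.mk.injEq]
  constructor
  · rintro ⟨hx, rfl⟩
    exact ⟨j, hx, rfl, rfl⟩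
  · rintro ⟨j', hx, rfl, rfl⟩
    exact ⟨hx, rfl⟩

theorem ncard_first_row_add (h : IsOnes v t) :
    {x ∈ ferrersDiagram v | x.1 = h.piv 0}.ncard + t 0 + 4 = n := by
  rw [ncard_row]
  have := h.ncard_row_add 0
  simp only [Fin.val_zero] at this
  omega

theorem ncard_other_rows_add (h : IsOnes v t) :
    {x ∈ ferrersDiagram v | x.1 ≠ h.piv 0}.ncard + t 1 + t 2 + t 3 + 6 = 3 * n := by
  rw [ncard_eq_sum_ncard_fiber, ← (Equiv.ofBijective _ h.piv_bijective).sum_comp,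
    Fin.sum_univ_four]
  have h1 := h.ncard_row_add 1
  have h2 := h.ncard_row_add 2
  have h3 := h.ncard_row_add 3
  have e : ∀ k : Fin 4, k ≠ 0 →
      {j | (h.piv k, j) ∈ {x ∈ ferrersDiagram v | x.1 ≠ h.piv 0}} =
        {j | (h.piv k, j) ∈ ferrersDiagram v} := by
    intro k hk
    ext j
    simp [h.piv_inj, hk]
  have e0 : {j | (h.piv 0, j) ∈ {x ∈ ferrersDiagram v | x.1 ≠ h.piv 0}} = ∅ := by
    ext j
    simp
  simp only [Equiv.ofBijective_apply, e0, e 1 (by decide), e 2 (by decide), e 3 (by decide),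
    Set.ncard_empty]
  have v1 : ((1 : Fin 4) : ℕ) = 1 := rfl
  have v2 : ((2 : Fin 4) : ℕ) = 2 := rfl
  have v3 : ((3 : Fin 4) : ℕ) = 3 := rfl
  omega

theorem ferrersBound_add (h : IsOnes v t) (hn : t 0 + 8 ≤ n) :
    ferrersBound (ferrersDiagram v) 2 + t 1 + t 2 + t 3 + 6 = 3 * n := by
  have h1 := h.ncard_first_row_add
  rw [ferrersBound_two _ h.piv_zero_le (by rw [h.card_piv]; omega)]
  exact h.ncard_other_rows_add

theorem exists_isFDMRD {F : Type*} [Field F] [Fintype F] (h : IsOnes v t) (hn : t 0 + 8 ≤ n) :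
    ∃ K : Submodule F (Matrix (Piv v) (NonPiv v) F), IsFDMRD (ferrersDiagram v) 2 K := by
  have h1 := h.ncard_first_row_add
  refine _root_.exists_isFDMRD _ h.piv_zero_le (by rw [h.card_piv]; omega) fun i j hij => ?_
  exact lt_of_le_of_lt (show (h.piv 0).1 ≤ i.1 from h.piv_zero_le i) hij

/-- The column following the first pivot, if it is not itself a pivot column. -/
def nextCol (h : IsOnes v t) (ht : t 0 + 1 < (t 1 : ℕ)) : NonPiv v :=
  ⟨⟨t 0 + 1, ht.trans (t 1).isLt⟩, by
    rw [← Bool.not_eq_true, h.eq_true_iff]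
    rintro ⟨k, hk⟩
    have hk' : (t k : ℕ) = t 0 + 1 := congrArg Fin.val hk
    by_cases h0 : k = 0
    · subst h0
      omega
    · have : t 1 ≤ t k := h.strictMono.monotone (Fin.one_le_of_ne_zero h0)
      have : (t 1 : ℕ) ≤ t k := this
      omega⟩

theorem mem_ferrersDiagram_nextCol (h : IsOnes v t) (ht : t 0 + 1 < (t 1 : ℕ)) (i : Piv v) :
    (i, h.nextCol ht) ∈ ferrersDiagram v ↔ i = h.piv 0 := by
  obtain ⟨k, rfl⟩ := h.piv_bijective.2 i
  have hval : (h.piv k, h.nextCol ht) ∈ ferrersDiagram v ↔ (t k : ℕ) < t 0 + 1 := Iff.rfl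
  rw [hval, h.piv_inj]
  constructor
  · intro hk
    by_contra h0
    have : t 1 ≤ t k := h.strictMono.monotone (Fin.one_le_of_ne_zero h0)
    have : (t 1 : ℕ) ≤ t k := this
    omega
  · rintro rfl
    omega

theorem ncard_first_row_diff_add (h : IsOnes v t) (ht : t 0 + 1 < (t 1 : ℕ)) :
    {x ∈ ferrersDiagram v \ {(h.piv 0, h.nextCol ht)} | x.1 = h.piv 0}.ncard + t 0 + 5 = n := by
  have h1 := h.ncard_first_row_add
  have : {x ∈ ferrersDiagram v \ {(h.piv 0, h.nextCol ht)} | x.1 = h.piv 0} =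
      {x ∈ ferrersDiagram v | x.1 = h.piv 0} \ {(h.piv 0, h.nextCol ht)} := by
    ext x
    simp only [Set.mem_ofPred_eq, Set.mem_sdiff]
    tauto
  have hmem : (h.piv 0, h.nextCol ht) ∈ {x ∈ ferrersDiagram v | x.1 = h.piv 0} :=
    ⟨(h.mem_ferrersDiagram_nextCol ht _).2 rfl, rfl⟩
  have h2 := Set.ncard_sdiff_singleton_add_one hmem
  rw [this]
  omega

theorem ferrersBound_diff (h : IsOnes v t) (ht : t 0 + 1 < (t 1 : ℕ)) (hn : t 0 + 9 ≤ n) :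
    ferrersBound (ferrersDiagram v \ {(h.piv 0, h.nextCol ht)}) 2 =
      ferrersBound (ferrersDiagram v) 2 := by
  have h1 := h.ncard_first_row_add
  have h2 := h.ncard_first_row_diff_add ht
  rw [ferrersBound_two _ h.piv_zero_le (by rw [h.card_piv]; omega),
    ferrersBound_two _ h.piv_zero_le (by rw [h.card_piv]; omega)]
  congr 1
  ext x
  simp only [Set.mem_ofPred_eq, Set.mem_sdiff, Set.mem_singleton_iff]
  constructor
  · exact fun hx => ⟨hx.1.1, hx.2⟩
  · exact fun hx => ⟨⟨hx.1, fun he => hx.2 (congrArg Prod.fst he)⟩, hx.2⟩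

/-- When the first row has a dot directly behind its pivot and is long enough, this dot is the
pending dot. -/
theorem pendingDot_eq (h : IsOnes v t) (ht : t 0 + 1 < (t 1 : ℕ)) (hn : t 0 + 9 ≤ n) :
    pendingDot v 2 = {(h.piv 0, h.nextCol ht)} := by
  have hmem := (h.mem_ferrersDiagram_nextCol ht _).2 rfl
  ext x
  simp only [pendingDot, Set.mem_ofPred_eq, Set.mem_singleton_iff]
  constructor
  · rintro ⟨hx, hrow, hcol, -⟩
    have h1 : x.1 = h.piv 0 := le_antisymm (hrow _) (h.piv_zero_le _)
    refine Prod.ext h1 (le_antisymm (hcol _ (h1 ▸ hmem)) ?_)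
    have hlt : x.1.1 < x.2.1 := hx
    rw [h1] at hlt
    exact Nat.succ_le_of_lt hlt
  · rintro rfl
    refine ⟨hmem, h.piv_zero_le, fun j hj => ?_, h.ferrersBound_diff ht hn⟩
    exact Nat.succ_le_of_lt hj

theorem ferrersBound_pending_add (h : IsOnes v t) (ht : t 0 + 1 < (t 1 : ℕ)) (hn : t 0 + 9 ≤ n) :
    ferrersBound (ferrersDiagram v \ pendingDot v 2) 2 + t 1 + t 2 + t 3 + 6 = 3 * n := by
  rw [h.pendingDot_eq ht hn, h.ferrersBound_diff ht hn]
  exact h.ferrersBound_add (by omega)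

theorem exists_isFDMRD_pending {F : Type*} [Field F] [Fintype F] (h : IsOnes v t)
    (ht : t 0 + 1 < (t 1 : ℕ)) (hn : t 0 + 9 ≤ n) :
    ∃ K : Submodule F (Matrix (Piv v) (NonPiv v) F),
      IsFDMRD (ferrersDiagram v \ pendingDot v 2) 2 K := by
  have h1 := h.ncard_first_row_diff_add ht
  rw [h.pendingDot_eq ht hn]
  refine _root_.exists_isFDMRD _ h.piv_zero_le (by rw [h.card_piv]; omega) fun i j hij => ?_
  refine ⟨lt_of_le_of_lt (show (h.piv 0).1 ≤ i.1 from h.piv_zero_le i) hij.1, fun he => ?_⟩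
  obtain rfl : j = h.nextCol ht := congrArg Prod.snd he
  exact hij.2 (by rw [(h.mem_ferrersDiagram_nextCol ht i).1 hij.1]; rfl)

/-- On the lifted subspaces, the value of the pending dot is the ratio of the two coordinates at
the first pivot and behind it. -/
theorem apply_nextCol_of_mem_liftSubspace {F : Type*} [Field F] (h : IsOnes v t)
    (ht : t 0 + 1 < (t 1 : ℕ)) (hn : t 0 + 9 ≤ n) {A : Matrix (Piv v) (NonPiv v) F}
    (hA : ∀ i j, (i, j) ∉ ferrersDiagram v \ pendingDot v 2 → A i j = 0) (a : F) {x : Fin n → F}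
    (hx : x ∈ liftSubspace v (A + pendingMatrix v 2 a)) :
    x (h.nextCol ht) = x (t 0) * a := by
  have hP := h.pendingDot_eq ht hn
  have hz : ∀ i, A i (h.nextCol ht) = 0 := by
    intro i
    refine hA _ _ fun hi => hi.2 ?_
    rw [hP, (h.mem_ferrersDiagram_nextCol ht i).1 hi.1]
    rfl
  rw [apply_eq_mul_of_mem_liftSubspace hx (i := h.piv 0)]
  · simp [hz, pendingMatrix, hP, piv]
  · intro i hi
    simp [hz, pendingMatrix, hP, hi]

end IsOnes

end WeightFour

/-! ### The matchings of the circle construction -/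

section Circle

/-- The number of nodes of `K_m` on the circle: `m` if `m` is odd, `m - 1` if `m` is even. -/
def circ (m : ℕ) : ℕ := 2 * ((m - 1) / 2) + 1

/-- The edges `{a, b}` with `a < b` of the class `P_i`, as ordered pairs. -/
def classEdges (m i : ℕ) : Finset (ℕ × ℕ) :=
  (Finset.Icc 1 m ×ˢ Finset.Icc 1 m).filter fun e => e.1 < e.2 ∧
    ((e.2 ≤ circ m ∧ e.1 + e.2 ≡ 2 * i [MOD circ m]) ∨ (circ m < e.2 ∧ e.1 ≡ i [MOD circ m]))

theorem mem_classEdges {m i : ℕ} {e : ℕ × ℕ} : e ∈ classEdges m i ↔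
    1 ≤ e.1 ∧ e.1 < e.2 ∧ e.2 ≤ m ∧ ((e.2 ≤ circ m ∧ e.1 + e.2 ≡ 2 * i [MOD circ m]) ∨
      (circ m < e.2 ∧ e.1 ≡ i [MOD circ m])) := by
  simp only [classEdges, Finset.mem_filter, Finset.mem_product, Finset.mem_Icc]
  constructor
  · rintro ⟨h, h1, h2⟩
    exact ⟨h.1.1, h1, h.2.2, h2⟩
  · rintro ⟨h1, h2, h3, h4⟩
    exact ⟨⟨⟨h1, by omega⟩, by omega, h3⟩, h2, h4⟩

theorem edgeVec_comm (m a b : ℕ) : edgeVec m a b = edgeVec m b a := by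
  funext j
  simp [edgeVec, or_comm]

theorem mem_oneFactor_iff {m i : ℕ} (hm : 2 ≤ m) (v : Fin m → Bool) :
    v ∈ oneFactor m i ↔ ∃ e ∈ classEdges m i, v = edgeVec m e.1 e.2 := by
  -- Unordered edges are written with the smaller label first.
  have horder : ∀ N, N ≤ m → N = circ m → (∃ a ∈ Finset.Icc 1 N, ∃ b ∈ Finset.Icc 1 N,
      a ≠ b ∧ a + b ≡ 2 * i [MOD N] ∧ v = edgeVec m a b) →
      ∃ e ∈ classEdges m i, v = edgeVec m e.1 e.2 := by
    rintro N hN hc ⟨a, ha, b, hb, hab, hmod, rfl⟩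
    rw [Finset.mem_Icc] at ha hb
    rcases lt_or_gt_of_ne hab with h | h
    · exact ⟨(a, b), mem_classEdges.2 ⟨ha.1, h, by omega, Or.inl ⟨hc ▸ hb.2, hc ▸ hmod⟩⟩, rfl⟩
    · exact ⟨(b, a), mem_classEdges.2 ⟨hb.1, h, by omega,
        Or.inl ⟨hc ▸ ha.2, hc ▸ (Nat.add_comm a b ▸ hmod)⟩⟩, edgeVec_comm m a b⟩
  rcases Nat.even_or_odd m with he | ho
  · have hc : m - 1 = circ m := by
      obtain ⟨k, hk⟩ := he
      unfold circ
      omega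
    rw [oneFactor, if_pos he]
    constructor
    · rintro (h | ⟨a, ha, hmod, rfl⟩)
      · exact horder (m - 1) (by omega) hc h
      · rw [Finset.mem_Icc] at ha
        exact ⟨(a, m), mem_classEdges.2 ⟨ha.1, by show a < m; omega, le_rfl,
          Or.inr ⟨by show circ m < m; omega, hc ▸ hmod⟩⟩, rfl⟩
    · rintro ⟨⟨a, b⟩, he, rfl⟩
      obtain ⟨h1, h2, h3, ⟨h4, h5⟩ | ⟨h4, h5⟩⟩ := mem_classEdges.1 he
      · simp only at h1 h2 h3 h4 h5
        exact Or.inl ⟨a, Finset.mem_Icc.2 ⟨h1, by omega⟩, b, Finset.mem_Icc.2 ⟨by omega, by omega⟩,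
          by omega, hc ▸ h5, rfl⟩
      · simp only at h1 h2 h3 h4 h5
        obtain rfl : b = m := by omega
        exact Or.inr ⟨a, Finset.mem_Icc.2 ⟨h1, by omega⟩, hc ▸ h5, rfl⟩
  · have hc : m = circ m := by
      obtain ⟨k, hk⟩ := ho
      unfold circ
      omega
    rw [oneFactor, if_neg (Nat.not_even_iff_odd.2 ho)]
    constructor
    · exact horder m le_rfl hc
    · rintro ⟨⟨a, b⟩, he, rfl⟩
      obtain ⟨h1, h2, h3, ⟨h4, h5⟩ | ⟨h4, h5⟩⟩ := mem_classEdges.1 he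
      · simp only at h1 h2 h3 h4 h5
        exact ⟨a, Finset.mem_Icc.2 ⟨h1, by omega⟩, b, Finset.mem_Icc.2 ⟨by omega, by omega⟩,
          by omega, hc.symm ▸ h5, rfl⟩
      · simp only at h1 h2 h3 h4 h5
        omega

theorem eq_of_modEq_of_lt {M i j : ℕ} (h : i ≡ j [MOD M]) (h1 : i < j + M) (h2 : j < i + M) :
    i = j := by
  have hd := Nat.modEq_iff_dvd.1 h
  have : (j : ℤ) - i = 0 := Int.eq_zero_of_abs_lt_dvd hd (by rw [abs_lt]; omega)
  omega

theorem modEq_of_two_mul_modEq {m i j : ℕ} (h : 2 * i ≡ 2 * j [MOD circ m]) :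
    i ≡ j [MOD circ m] := by
  refine Nat.ModEq.cancel_left_of_coprime ?_ h
  exact (Nat.coprime_two_right.2 (by simp [circ]))

/-- The classes of incongruent indices are disjoint. -/
theorem modEq_of_mem_classEdges {m i j : ℕ} {e : ℕ × ℕ} (hi : e ∈ classEdges m i)
    (hj : e ∈ classEdges m j) : i ≡ j [MOD circ m] := by
  obtain ⟨-, -, -, ⟨h1, h2⟩ | ⟨h1, h2⟩⟩ := mem_classEdges.1 hi <;>
  obtain ⟨-, -, -, ⟨h3, h4⟩ | ⟨h3, h4⟩⟩ := mem_classEdges.1 hj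
  · exact modEq_of_two_mul_modEq (h2.symm.trans h4)
  · omega
  · omega
  · exact h2.symm.trans h4

theorem index_eq_of_mem_classEdges {m i j : ℕ} (hm : 2 ≤ m) (hi : 2 ≤ i ∧ i ≤ m)
    (hj : 2 ≤ j ∧ j ≤ m) {e : ℕ × ℕ} (hei : e ∈ classEdges m i) (hej : e ∈ classEdges m j) :
    i = j := by
  have : m ≤ circ m + 1 := by unfold circ; omega
  exact eq_of_modEq_of_lt (modEq_of_mem_classEdges hei hej) (by omega) (by omega)

/-- The nodes `x` and `y` are joined by an edge of the class `P_i`. -/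
def ClassAdj (m i x y : ℕ) : Prop := (x, y) ∈ classEdges m i ∨ (y, x) ∈ classEdges m i

theorem ClassAdj.symm {m i x y : ℕ} (h : ClassAdj m i x y) : ClassAdj m i y x := Or.symm h

/-- The classes are matchings: a node has at most one partner. -/
theorem ClassAdj.unique {m i x y z : ℕ} (hm : 2 ≤ m) (hy : ClassAdj m i x y) (hz : ClassAdj m i x z) :
    y = z := by
  have hc : m ≤ circ m + 1 := by unfold circ; omega
  have key : ∀ {x y}, ClassAdj m i x y → 1 ≤ x ∧ 1 ≤ y ∧ x ≤ m ∧ y ≤ m ∧ x ≠ y ∧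
      ((x ≤ circ m ∧ y ≤ circ m ∧ x + y ≡ 2 * i [MOD circ m]) ∨
        (circ m < y ∧ x ≤ circ m ∧ x ≡ i [MOD circ m]) ∨
        (circ m < x ∧ y ≤ circ m ∧ y ≡ i [MOD circ m])) := by
    rintro x y (h | h) <;>
    obtain ⟨h1, h2, h3, ⟨h4, h5⟩ | ⟨h4, h5⟩⟩ := mem_classEdges.1 h <;>
    simp only at h1 h2 h3 h4 h5
    · exact ⟨h1, by omega, by omega, by omega, by omega, Or.inl ⟨by omega, by omega, h5⟩⟩
    · exact ⟨h1, by omega, by omega, by omega, by omega, Or.inr (Or.inl ⟨by omega, by omega, h5⟩)⟩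
    · exact ⟨by omega, by omega, by omega, by omega, by omega,
        Or.inl ⟨by omega, by omega, Nat.add_comm y x ▸ h5⟩⟩
    · exact ⟨by omega, by omega, by omega, by omega, by omega,
        Or.inr (Or.inr ⟨by omega, by omega, h5⟩)⟩
  -- The node `i` is its own mirror image, so it has no partner on the circle.
  have self : ∀ {x y}, x + y ≡ 2 * i [MOD circ m] → x ≡ i [MOD circ m] → y ≡ x [MOD circ m] := by
    intro x y h1 h2
    refine Nat.ModEq.add_left_cancel' x (h1.trans ?_)
    rw [two_mul]
    exact (h2.add h2).symm
  obtain ⟨hx1, hy1, hxm, hym, hxy, hy⟩ := key hy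
  obtain ⟨-, hz1, -, hzm, hxz, hz⟩ := key hz
  rcases hy with ⟨h1, h2, h3⟩ | ⟨h1, h2, h3⟩ | ⟨h1, h2, h3⟩ <;>
  rcases hz with ⟨g1, g2, g3⟩ | ⟨g1, g2, g3⟩ | ⟨g1, g2, g3⟩
  · exact eq_of_modEq_of_lt (Nat.ModEq.add_left_cancel' x (h3.trans g3.symm)) (by omega) (by omega)
  · exact absurd (eq_of_modEq_of_lt (self h3 g3) (by omega) (by omega)) hxy.symm
  · omega
  · exact absurd (eq_of_modEq_of_lt (self g3 h3) (by omega) (by omega)) hxz.symm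
  · omega
  · omega
  · omega
  · omega
  · exact eq_of_modEq_of_lt (h3.trans g3.symm) (by omega) (by omega)

/-- Two different edges of a class are disjoint. -/
theorem disjoint_of_mem_classEdges {m i : ℕ} (hm : 2 ≤ m) {e f : ℕ × ℕ} (he : e ∈ classEdges m i)
    (hf : f ∈ classEdges m i) (hne : e ≠ f) :
    e.1 ≠ f.1 ∧ e.1 ≠ f.2 ∧ e.2 ≠ f.1 ∧ e.2 ≠ f.2 := by
  have he' : ClassAdj m i e.1 e.2 := Or.inl he
  have hf' : ClassAdj m i f.1 f.2 := Or.inl hf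
  have he1 := (mem_classEdges.1 he).2.1
  have hf1 := (mem_classEdges.1 hf).2.1
  refine ⟨fun h => ?_, fun h => ?_, fun h => ?_, fun h => ?_⟩
  · exact hne (Prod.ext h (ClassAdj.unique hm he' (h ▸ hf')))
  · have h2 : e.2 = f.1 := ClassAdj.unique hm he' (h ▸ hf'.symm)
    omega
  · have h2 : e.1 = f.2 := ClassAdj.unique hm he'.symm (h ▸ hf')
    omega
  · exact hne (Prod.ext (ClassAdj.unique hm he'.symm (h ▸ hf'.symm)) h)

/-- The pairs `a < b` of nodes among `1, …, M` with sum `T`. -/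
def pairsWithSum (M T : ℕ) : Finset (ℕ × ℕ) :=
  (Finset.Icc (max 1 (T - M)) ((T - 1) / 2)).image fun a => (a, T - a)

theorem mem_pairsWithSum {M T : ℕ} {e : ℕ × ℕ} :
    e ∈ pairsWithSum M T ↔ 1 ≤ e.1 ∧ e.1 < e.2 ∧ e.2 ≤ M ∧ e.1 + e.2 = T := by
  obtain ⟨a, b⟩ := e
  simp only [pairsWithSum, Finset.mem_image, Finset.mem_Icc, Prod.mk.injEq]
  constructor
  · rintro ⟨a', h, rfl, rfl⟩
    omega
  · intro h
    exact ⟨a, by omega, rfl, by omega⟩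

theorem card_pairsWithSum (M T : ℕ) :
    (pairsWithSum M T).card = (T - 1) / 2 + 1 - max 1 (T - M) := by
  rw [pairsWithSum, Finset.card_image_of_injective _ fun a b h => (Prod.ext_iff.1 h).1,
    Nat.card_Icc]

theorem sum_pairsWithSum (M T : ℕ) (f : ℕ → ℚ) :
    ∑ e ∈ pairsWithSum M T, f (e.1 + e.2) =
      (((T - 1) / 2 + 1 - max 1 (T - M) : ℕ) : ℚ) * f T := by
  rw [← card_pairsWithSum, ← nsmul_eq_mul]
  exact Finset.sum_eq_card_nsmul fun e he => by rw [(mem_pairsWithSum.1 he).2.2.2]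

/-- The edges of a class on the circle have at most two different sums, which differ by the length
of the circle. If `m` is even there is one more edge, to the central node. -/
theorem classEdges_eq_union {m i s a : ℕ} (hm : 2 ≤ m) (hs : s ≡ 2 * i [MOD circ m])
    (hs1 : s ≤ circ m + 2) (hs2 : 2 ≤ s) (ha : a ≡ i [MOD circ m]) (ha1 : 1 ≤ a)
    (ha2 : a ≤ circ m) :
    classEdges m i = pairsWithSum (circ m) s ∪ (pairsWithSum (circ m) (s + circ m) ∪
      if circ m < m then {(a, m)} else ∅) := by
  have hc : circ m ≤ m ∧ m ≤ circ m + 1 := by unfold circ; omega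
  ext e
  rw [Finset.mem_union, Finset.mem_union, mem_pairsWithSum, mem_pairsWithSum, mem_classEdges]
  constructor
  · rintro ⟨h1, h2, h3, ⟨h4, h5⟩ | ⟨h4, h5⟩⟩
    · by_cases h : e.1 + e.2 < s + circ m
      · exact Or.inl ⟨h1, h2, h4, eq_of_modEq_of_lt (h5.trans hs.symm) h (by omega)⟩
      · refine Or.inr (Or.inl ⟨h1, h2, h4, eq_of_modEq_of_lt
          ((h5.trans hs.symm).trans ?_) (by omega) (by omega)⟩)
        simp [Nat.ModEq]
    · refine Or.inr (Or.inr ?_)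
      rw [if_pos (by omega), Finset.mem_singleton]
      refine Prod.ext ?_ (show e.2 = m by omega)
      exact eq_of_modEq_of_lt (h5.trans ha.symm) (by omega) (by omega)
  · rintro (⟨h1, h2, h3, h4⟩ | ⟨h1, h2, h3, h4⟩ | h)
    · exact ⟨h1, h2, by omega, Or.inl ⟨h3, h4 ▸ hs⟩⟩
    · refine ⟨h1, h2, by omega, Or.inl ⟨h3, h4 ▸ ?_⟩⟩
      exact Nat.ModEq.trans (by simp [Nat.ModEq]) hs
    · split_ifs at h with hlt
      · obtain rfl := Finset.mem_singleton.1 h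
        exact ⟨ha1, by show a < m; omega, le_rfl, Or.inr ⟨hlt, ha⟩⟩
      · simp at h

theorem sum_classEdges {m i s a : ℕ} (hm : 2 ≤ m) (hs : s ≡ 2 * i [MOD circ m])
    (hs1 : s ≤ circ m + 2) (hs2 : 2 ≤ s) (ha : a ≡ i [MOD circ m]) (ha1 : 1 ≤ a)
    (ha2 : a ≤ circ m) (f : ℕ → ℚ) :
    ∑ e ∈ classEdges m i, f (e.1 + e.2) =
      (((s - 1) / 2 + 1 - max 1 (s - circ m) : ℕ) : ℚ) * f s +
      (((s + circ m - 1) / 2 + 1 - max 1 s : ℕ) : ℚ) * f (s + circ m) +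
      if circ m < m then f (a + m) else 0 := by
  rw [classEdges_eq_union hm hs hs1 hs2 ha ha1 ha2, Finset.sum_union, Finset.sum_union,
    sum_pairsWithSum, sum_pairsWithSum, Nat.add_sub_cancel, add_assoc]
  · split_ifs <;> simp
  · rw [Finset.disjoint_left]
    intro e he h
    rw [mem_pairsWithSum] at he
    split_ifs at h
    · obtain rfl := Finset.mem_singleton.1 h
      simp only at he
      omega
    · simp at h
  · rw [Finset.disjoint_left]
    intro e he h
    rw [mem_pairsWithSum] at he
    have : 1 ≤ circ m := by unfold circ; omega
    rcases Finset.mem_union.1 h with h | h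
    · have := (mem_pairsWithSum.1 h).2.2.2
      omega
    · split_ifs at h
      · obtain rfl := Finset.mem_singleton.1 h
        simp only at he
        omega
      · simp at h

end Circle

/-! ### Distances between lifted subspaces -/

section Distance

variable {F : Type*} [Field F] {n : ℕ} {v w : Fin n → Bool} {t : Fin 4 → Fin n}

namespace IsOnes

theorem finrank_liftSubspace (h : IsOnes v t) (A : Matrix (Piv v) (NonPiv v) F) :
    Module.finrank F (liftSubspace v A) = 4 :=
  (_root_.finrank_liftSubspace v A).trans h.card_piv

/-- Two of the four pivots drop out if each of them is not a pivot of the other subspace, or the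
corresponding coordinate vanishes on the intersection. -/
theorem finrank_inf_le_two (h : IsOnes v t) {A : Matrix (Piv v) (NonPiv v) F}
    {B : Matrix (Piv w) (NonPiv w) F} (hA : ∀ i j, (i, j) ∉ ferrersDiagram v → A i j = 0)
    (hB : ∀ i j, (i, j) ∉ ferrersDiagram w → B i j = 0) {k l : Fin 4} (hkl : k ≠ l)
    (hk : w (t k) = true → ∀ x ∈ liftSubspace v A ⊓ liftSubspace w B, x (t k) = 0)
    (hl : w (t l) = true → ∀ x ∈ liftSubspace v A ⊓ liftSubspace w B, x (t l) = 0) :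
    Module.finrank F (liftSubspace v A ⊓ liftSubspace w B : Submodule F (Fin n → F)) ≤ 2 := by
  refine (finrank_inf_liftSubspace_le hA hB (({k, l} : Finset (Fin 4))ᶜ.image t) ?_).trans
    (Finset.card_image_le.trans ?_)
  · intro p hp hwp hpT
    obtain ⟨r, rfl⟩ := (h.eq_true_iff p).1 hp
    by_cases hr : r ∈ ({k, l} : Finset (Fin 4))
    · rcases Finset.mem_insert.1 hr with rfl | hr
      · exact hk hwp
      · obtain rfl := Finset.mem_singleton.1 hr
        exact hl hwp
    · exact absurd (Finset.mem_image_of_mem t (Finset.mem_compl.2 hr)) hpT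
  · rw [Finset.card_compl, Finset.card_pair hkl, Fintype.card_fin]

theorem finrank_inf_le_two_of_ne (h : IsOnes v t) {A B : Matrix (Piv v) (NonPiv v) F}
    (hr : 2 ≤ (A - B).rank) :
    Module.finrank F (liftSubspace v A ⊓ liftSubspace v B : Submodule F (Fin n → F)) ≤ 2 := by
  have := finrank_inf_liftSubspace_add_rank_le v A B
  have := h.card_piv
  omega

theorem finrank_inf_le_two_of_forall_eq_zero (h : IsOnes v t) (A : Matrix (Piv v) (NonPiv v) F)
    {W : Submodule F (Fin n → F)} (hW : ∀ x ∈ W, x (t 0) = 0 ∧ x (t 1) = 0) :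
    Module.finrank F (liftSubspace v A ⊓ W : Submodule F (Fin n → F)) ≤ 2 := by
  refine (finrank_le_card_of_forall_eq_zero _ {t 2, t 3} ?_).trans Finset.card_le_two
  intro x hx hT
  refine eq_zero_of_mem_liftSubspace hx.1 fun i => ?_
  obtain ⟨k, rfl⟩ := h.piv_bijective.2 i
  show x (t k) = 0
  fin_cases k
  · exact (hW x hx.2).1
  · exact (hW x hx.2).2
  · exact hT _ (by simp)
  · exact hT _ (by simp)

/-- If two matrices agree in two rows, the lifted subspaces share the corresponding vectors. -/
theorem two_le_finrank_inf (h : IsOnes v t) {A B : Matrix (Piv v) (NonPiv v) F}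
    (h2 : A (h.piv 2) = B (h.piv 2)) (h3 : A (h.piv 3) = B (h.piv 3)) :
    2 ≤ Module.finrank F (liftSubspace v A ⊓ liftSubspace v B : Submodule F (Fin n → F)) := by
  have hinj : Function.Injective (fun k : Fin 2 => h.piv (Fin.natAdd 2 k)) := fun k l hkl => by
    have := congrArg Fin.val (h.piv_bijective.1 hkl)
    exact Fin.ext (by simpa using this)
  have hli := (linearIndependent_reMatrix v A).comp _ hinj
  have hrow : ∀ i, A i = B i → reMatrix v A i = reMatrix v B i := by
    intro i hi
    funext j
    simp [reMatrix, hi]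
  have hle : Submodule.span F (Set.range ((fun i => reMatrix v A i) ∘
      fun k : Fin 2 => h.piv (Fin.natAdd 2 k))) ≤ liftSubspace v A ⊓ liftSubspace v B := by
    rw [Submodule.span_le]
    rintro _ ⟨k, rfl⟩
    refine ⟨reMatrix_mem_liftSubspace v A _, ?_⟩
    show reMatrix v A (h.piv (Fin.natAdd 2 k)) ∈ liftSubspace v B
    rw [hrow]
    · exact reMatrix_mem_liftSubspace v B _
    · fin_cases k
      · exact h2
      · exact h3
  have := Submodule.finrank_mono hle
  rwa [finrank_span_eq_card hli, Fintype.card_fin] at this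

/-- A linear code of large dimension has a nonzero member supported in the first two rows. -/
theorem exists_mem_rows_eq_zero (h : IsOnes v t)
    (K : Submodule F (Matrix (Piv v) (NonPiv v) F))
    (hK : 2 * Fintype.card (NonPiv v) < Module.finrank F K) :
    ∃ A ∈ K, A ≠ 0 ∧ A (h.piv 2) = 0 ∧ A (h.piv 3) = 0 := by
  let f : K →ₗ[F] (NonPiv v → F) × (NonPiv v → F) :=
    (LinearMap.prod (LinearMap.proj (h.piv 2)) (LinearMap.proj (h.piv 3)) :
      (Piv v → NonPiv v → F) →ₗ[F] (NonPiv v → F) × (NonPiv v → F)).comp K.subtype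
  have hf : LinearMap.ker f ≠ ⊥ := by
    apply LinearMap.ker_ne_bot_of_finrank_lt
    rw [Module.finrank_prod, Module.finrank_fintype_fun_eq_card]
    omega
  obtain ⟨A, hA, hne⟩ := (Submodule.ne_bot_iff _).1 hf
  have hA' := LinearMap.mem_ker.1 hA
  exact ⟨A, A.2, fun h0 => hne (Subtype.ext h0), congrArg Prod.fst hA', congrArg Prod.snd hA'⟩

end IsOnes

end Distance

/-! ### The identifying vectors of the construction -/

section IdentifyingVectors

/-- The vector of length `n` with ones at the positions `r`, `s` of its first four entries and
at the positions `a`, `b` of the remaining ones (positions being counted from one). -/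
def idVec (n r s a b : ℕ) : Fin n → Bool :=
  concatVec (edgeVec 4 r s) (edgeVec (n - 4) a b)

theorem idVec_eq_true_iff {n r s a b : ℕ} (i : Fin n) : idVec n r s a b i = true ↔
    (i.1 < 4 ∧ (i.1 + 1 = r ∨ i.1 + 1 = s)) ∨
      (4 ≤ i.1 ∧ (i.1 = a + 3 ∨ i.1 = b + 3)) := by
  unfold idVec concatVec edgeVec
  split_ifs with h
  · simp only [decide_eq_true_eq]
    omega
  · simp only [decide_eq_true_eq]
    omega

theorem exists_isOnes_idVec {n r s a b : ℕ} (hr : 1 ≤ r) (hrs : r < s) (hs : s ≤ 4) (ha : 1 ≤ a)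
    (hab : a < b) (hb : b ≤ n - 4) : ∃ t : Fin 4 → Fin n, IsOnes (idVec n r s a b) t ∧
      (t 0 : ℕ) + 1 = r ∧ (t 1 : ℕ) + 1 = s ∧ (t 2 : ℕ) = a + 3 ∧ (t 3 : ℕ) = b + 3 := by
  refine ⟨![⟨r - 1, by omega⟩, ⟨s - 1, by omega⟩, ⟨a + 3, by omega⟩, ⟨b + 3, by omega⟩],
    ⟨?_, ?_⟩, Nat.sub_add_cancel hr, Nat.sub_add_cancel (by omega), rfl, rfl⟩
  · rw [Fin.strictMono_iff_lt_succ]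
    intro k
    fin_cases k
    · show r - 1 < s - 1
      omega
    · show s - 1 < a + 3
      omega
    · show a + 3 < b + 3
      omega
  · intro i
    rw [idVec_eq_true_iff, Fin.exists_fin_succ, Fin.exists_fin_succ, Fin.exists_fin_two]
    simp only [Fin.ext_iff]
    show _ ↔ r - 1 = i.1 ∨ s - 1 = i.1 ∨ a + 3 = i.1 ∨ b + 3 = i.1
    omega

/-- The identifying vector `(1111 || 0…0)`. -/
def topVec (n : ℕ) : Fin n → Bool :=
  concatVec ![true, true, true, true] (fun _ : Fin (n - 4) => false)

theorem topVec_eq_true_iff {n : ℕ} (i : Fin n) : topVec n i = true ↔ i.1 < 4 := by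
  unfold topVec concatVec
  split_ifs with h
  · obtain ⟨i, hi⟩ := i
    simp only at h
    interval_cases i <;> simp
  · simpa using h

theorem isOnes_topVec {n : ℕ} (hn : 4 ≤ n) : IsOnes (topVec n) (Fin.castLE hn) where
  strictMono := Fin.strictMono_castLE hn
  eq_true_iff i := by
    rw [topVec_eq_true_iff]
    constructor
    · exact fun h => ⟨⟨i, h⟩, rfl⟩
    · rintro ⟨k, rfl⟩
      exact k.2

theorem concatVec_left_inj {α : Type*} {k n : ℕ} (hkn : k ≤ n) {x x' : Fin k → α}
    {y y' : Fin (n - k) → α} (h : concatVec x y = concatVec x' y') : x = x' := by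
  funext i
  have := congrFun h (Fin.castLE hkn i)
  simpa [concatVec] using this

/-- The selected class indices as a finite set. -/
def classFinset (q m : ℕ) : Finset ℕ :=
  (Finset.Icc 2 (min ((q + 1) / 2 + 1) (m / 2))).image (fun i => (m + 1) / 2 + i) ∪
    Finset.Icc 3 (min (q / 2 + 2) ((m + 1) / 2))

theorem mem_classFinset {q m j : ℕ} :
    j ∈ classFinset q m ↔ j ∈ ConstructionC4.classIndices q m := by
  simp only [classFinset, ConstructionC4.classIndices, Finset.mem_union, Finset.mem_image,
    Finset.mem_Icc, Set.mem_ofPred_eq]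
  refine or_congr (exists_congr fun i => ?_) Iff.rfl
  constructor
  · rintro ⟨⟨h1, h2⟩, h3⟩
    exact ⟨h1, h2, h3.symm⟩
  · rintro ⟨h1, h2, h3⟩
    exact ⟨⟨h1, h2⟩, h3.symm⟩

theorem bounds_of_mem_classFinset {q m j : ℕ} (h : j ∈ classFinset q m) :
    3 ≤ j ∧ j ≤ m ∧ j ≠ (m + 1) / 2 + 1 := by
  simp only [classFinset, Finset.mem_union, Finset.mem_image, Finset.mem_Icc] at h
  rcases h with ⟨i, hi, rfl⟩ | h <;> omega

theorem sum_classFinset (q m : ℕ) (f : ℕ → ℚ) : ∑ j ∈ classFinset q m, f j =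
    ∑ i ∈ Finset.Icc 2 (min ((q + 1) / 2 + 1) (m / 2)), f ((m + 1) / 2 + i) +
      ∑ j ∈ Finset.Icc 3 (min (q / 2 + 2) ((m + 1) / 2)), f j := by
  rw [classFinset, Finset.sum_union, Finset.sum_image fun a _ b _ h => Nat.add_left_cancel h]
  rw [Finset.disjoint_left]
  intro j hj h
  simp only [Finset.mem_image, Finset.mem_Icc] at hj h
  obtain ⟨i, hi, rfl⟩ := hj
  omega

theorem card_classFinset_le (q m : ℕ) (hm : 2 ≤ m) : (classFinset q m).card ≤ q := by
  refine (Finset.card_union_le _ _).trans ?_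
  have := Finset.card_image_le (s := Finset.Icc 2 (min ((q + 1) / 2 + 1) (m / 2)))
    (f := fun i => (m + 1) / 2 + i)
  rw [Nat.card_Icc] at this ⊢
  omega

/-- The triples `(r, s, j)` of the ones `r < s` of a prefix and the index `j` of a class used with
it, for the prefixes of weight two. -/
def labels (q n : ℕ) : Finset (ℕ × ℕ × ℕ) :=
  {(1, 2, (n - 4 + 1) / 2 + 1), (3, 4, (n - 4 + 1) / 2 + 1), (1, 4, 2), (2, 3, 2)} ∪
    ((classFinset q (n - 4)).image (fun j => (1, 3, j)) ∪
      (classFinset q (n - 4)).image (fun j => (2, 4, j)))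

theorem mem_labels {q n : ℕ} {r s j : ℕ} : (r, s, j) ∈ labels q n ↔
    ((r = 1 ∧ s = 2 ∨ r = 3 ∧ s = 4) ∧ j = (n - 4 + 1) / 2 + 1) ∨
    ((r = 1 ∧ s = 4 ∨ r = 2 ∧ s = 3) ∧ j = 2) ∨
    ((r = 1 ∧ s = 3 ∨ r = 2 ∧ s = 4) ∧ j ∈ classFinset q (n - 4)) := by
  simp only [labels, Finset.mem_union, Finset.mem_insert, Finset.mem_singleton, Finset.mem_image,
    Prod.mk.injEq]
  constructor
  · rintro ((h | h | h | h) | ⟨j', h, rfl, rfl, rfl⟩ | ⟨j', h, rfl, rfl, rfl⟩)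
    · exact Or.inl ⟨Or.inl ⟨h.1, h.2.1⟩, h.2.2⟩
    · exact Or.inl ⟨Or.inr ⟨h.1, h.2.1⟩, h.2.2⟩
    · exact Or.inr (Or.inl ⟨Or.inl ⟨h.1, h.2.1⟩, h.2.2⟩)
    · exact Or.inr (Or.inl ⟨Or.inr ⟨h.1, h.2.1⟩, h.2.2⟩)
    · exact Or.inr (Or.inr ⟨Or.inl ⟨rfl, rfl⟩, h⟩)
    · exact Or.inr (Or.inr ⟨Or.inr ⟨rfl, rfl⟩, h⟩)
  · rintro (⟨⟨rfl, rfl⟩ | ⟨rfl, rfl⟩, rfl⟩ | ⟨⟨rfl, rfl⟩ | ⟨rfl, rfl⟩, rfl⟩ |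
      ⟨⟨rfl, rfl⟩ | ⟨rfl, rfl⟩, h⟩)
    · simp
    · simp
    · simp
    · simp
    · exact Or.inr (Or.inl ⟨j, h, rfl, rfl, rfl⟩)
    · exact Or.inr (Or.inr ⟨j, h, rfl, rfl, rfl⟩)

theorem sum_labels (q n : ℕ) (f : ℕ × ℕ × ℕ → ℚ) : ∑ ℓ ∈ labels q n, f ℓ =
    f (1, 2, (n - 4 + 1) / 2 + 1) + f (3, 4, (n - 4 + 1) / 2 + 1) + f (1, 4, 2) + f (2, 3, 2) +
      ∑ j ∈ classFinset q (n - 4), (f (1, 3, j) + f (2, 4, j)) := by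
  rw [labels, Finset.sum_union, Finset.sum_union, Finset.sum_image, Finset.sum_image,
    Finset.sum_add_distrib]
  · rw [Finset.sum_insert (by simp), Finset.sum_insert (by simp), Finset.sum_insert (by simp),
      Finset.sum_singleton]
    ring
  · intro a _ b _ h
    simpa using h
  · intro a _ b _ h
    simpa using h
  · rw [Finset.disjoint_left]
    intro x hx hy
    obtain ⟨_, _, rfl⟩ := Finset.mem_image.1 hx
    simp at hy
  · rw [Finset.disjoint_left]
    intro x hx hy
    rcases Finset.mem_union.1 hy with hy | hy <;>
    · obtain ⟨_, _, rfl⟩ := Finset.mem_image.1 hy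
      simp at hx

theorem bounds_of_mem_labels {q n r s j : ℕ} (hn : 10 ≤ n) (h : (r, s, j) ∈ labels q n) :
    1 ≤ r ∧ r < s ∧ s ≤ 4 ∧ 2 ≤ j ∧ j ≤ n - 4 := by
  rcases mem_labels.1 h with ⟨h, hj⟩ | ⟨h, hj⟩ | ⟨h, hj⟩
  · omega
  · omega
  · have := bounds_of_mem_classFinset hj
    omega

/-- A class is used with one prefix and its complement only, and a prefix different from `1010` and
`0101` with one class only. -/
theorem labels_compatible {q n r s j r' s' j' : ℕ} (hn : 10 ≤ n) (h : (r, s, j) ∈ labels q n)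
    (h' : (r', s', j') ∈ labels q n) :
    (j = j' → (r = r' ∧ s = s') ∨ (r ≠ r' ∧ r ≠ s' ∧ s ≠ r' ∧ s ≠ s')) ∧
      (r = r' ∧ s = s' → j = j' ∨ s = r + 2) := by
  rcases mem_labels.1 h with ⟨h, hj⟩ | ⟨h, hj⟩ | ⟨h, hj⟩ <;>
  rcases mem_labels.1 h' with ⟨h', hj'⟩ | ⟨h', hj'⟩ | ⟨h', hj'⟩ <;>
  (try have := bounds_of_mem_classFinset hj) <;>
  (try have := bounds_of_mem_classFinset hj') <;>
  omega

end IdentifyingVectors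

/-! ### Minimum distance and cardinality of the construction -/

section Layers

variable {F : Type*} [Field F]

theorem pendingMatrix_zero {n : ℕ} (v : Fin n → Bool) (d : ℕ) :
    pendingMatrix v d (0 : F) = 0 := by
  ext i j
  simp [pendingMatrix]

theorem pendingMatrix_eq_zero {n : ℕ} {v : Fin n → Bool} {d : ℕ} {a : F} {i : Piv v}
    {j : NonPiv v} (h : (i, j) ∉ ferrersDiagram v) : pendingMatrix v d a i j = 0 :=
  if_neg fun hp => h hp.1

/-- The rank-metric codes `K` and the values `off` of the pending dots are an admissible choice in
the construction. The value `off` is zero for the prefixes whose pending dot is not used, so that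
all layers have the same form. -/
structure IsChoice (q n : ℕ) (K : ∀ v : Fin n → Bool, Submodule F (Matrix (Piv v) (NonPiv v) F))
    (off : ℕ × ℕ × ℕ → F) : Prop where
  top : IsFDMRD (ferrersDiagram (topVec n)) 2 (K (topVec n))
  plain : ∀ r s j, (r, s, j) ∈ labels q n → s ≠ r + 2 → off (r, s, j) = 0 ∧
    ∀ e ∈ classEdges (n - 4) j, IsFDMRD (ferrersDiagram (idVec n r s e.1 e.2)) 2
      (K (idVec n r s e.1 e.2))
  pending : ∀ r s j, (r, s, j) ∈ labels q n → s = r + 2 →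
    ∀ e ∈ classEdges (n - 4) j, IsFDMRD (ferrersDiagram (idVec n r s e.1 e.2) \
      pendingDot (idVec n r s e.1 e.2) 2) 2 (K (idVec n r s e.1 e.2))
  off_inj : ∀ r s j j', (r, s, j) ∈ labels q n → (r, s, j') ∈ labels q n → s = r + 2 →
    off (r, s, j) = off (r, s, j') → j = j'

/-- The labels of the layers with prefixes of weight two: a prefix and a class with an edge of the
class. -/
def layerLabels (q n : ℕ) : Finset (Σ _ : ℕ × ℕ × ℕ, ℕ × ℕ) :=
  (labels q n).sigma fun ℓ => classEdges (n - 4) ℓ.2.2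

theorem mem_layerLabels {q n : ℕ} {x : Σ _ : ℕ × ℕ × ℕ, ℕ × ℕ} :
    x ∈ layerLabels q n ↔ x.1 ∈ labels q n ∧ x.2 ∈ classEdges (n - 4) x.1.2.2 :=
  Finset.mem_sigma

-- Membership is used through `mem_layerLabels` only; unfolding the finset is expensive.
attribute [irreducible] layerLabels

/-- The identifying vector of a layer. -/
abbrev layerVec (n : ℕ) (x : Σ _ : ℕ × ℕ × ℕ, ℕ × ℕ) : Fin n → Bool :=
  idVec n x.1.1 x.1.2.1 x.2.1 x.2.2

/-- The lifted members of the code `K` with the chosen value put at the pending dot. -/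
noncomputable def layerSpace {n : ℕ} (off : ℕ × ℕ × ℕ → F) (x : Σ _ : ℕ × ℕ × ℕ, ℕ × ℕ)
    (A : Matrix (Piv (layerVec n x)) (NonPiv (layerVec n x)) F) : Submodule F (Fin n → F) :=
  liftSubspace (layerVec n x) (A + pendingMatrix (layerVec n x) 2 (off x.1))

namespace IsChoice

variable {q n : ℕ} {K : ∀ v : Fin n → Bool, Submodule F (Matrix (Piv v) (NonPiv v) F)}
  {off : ℕ × ℕ × ℕ → F} {x y : Σ _ : ℕ × ℕ × ℕ, ℕ × ℕ}

theorem exists_isOnes (hn : 10 ≤ n) (hx : x ∈ layerLabels q n) : ∃ t : Fin 4 → Fin n,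
    IsOnes (layerVec n x) t ∧ (t 0 : ℕ) + 1 = x.1.1 ∧ (t 1 : ℕ) + 1 = x.1.2.1 ∧
      (t 2 : ℕ) = x.2.1 + 3 ∧ (t 3 : ℕ) = x.2.2 + 3 := by
  obtain ⟨hl, he⟩ := mem_layerLabels.1 hx
  obtain ⟨h1, h2, h3, -⟩ := bounds_of_mem_labels hn hl
  obtain ⟨g1, g2, g3, -⟩ := mem_classEdges.1 he
  exact exists_isOnes_idVec h1 h2 h3 g1 g2 g3

theorem apply_eq_zero (hc : IsChoice q n K off) (hx : x ∈ layerLabels q n)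
    {A : Matrix (Piv (layerVec n x)) (NonPiv (layerVec n x)) F} (hA : A ∈ K (layerVec n x))
    (i : Piv (layerVec n x)) (j : NonPiv (layerVec n x))
    (hij : (i, j) ∉ ferrersDiagram (layerVec n x)) :
    (A + pendingMatrix (layerVec n x) 2 (off x.1)) i j = 0 := by
  obtain ⟨hl, he⟩ := mem_layerLabels.1 hx
  rw [Matrix.add_apply, pendingMatrix_eq_zero hij, add_zero]
  by_cases hs : x.1.2.1 = x.1.1 + 2
  · exact (hc.pending _ _ _ hl hs _ he).1 A hA i j fun h => hij h.1
  · exact ((hc.plain _ _ _ hl hs).2 _ he).1 A hA i j hij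

theorem two_le_rank (hc : IsChoice q n K off) (hx : x ∈ layerLabels q n)
    {A B : Matrix (Piv (layerVec n x)) (NonPiv (layerVec n x)) F} (hA : A ∈ K (layerVec n x))
    (hB : B ∈ K (layerVec n x)) (hAB : A ≠ B) : 2 ≤ (A - B).rank := by
  obtain ⟨hl, he⟩ := mem_layerLabels.1 hx
  by_cases hs : x.1.2.1 = x.1.1 + 2
  · exact (hc.pending _ _ _ hl hs _ he).2.1 A hA B hB hAB
  · exact ((hc.plain _ _ _ hl hs).2 _ he).2.1 A hA B hB hAB

theorem finrank_layerSpace (hn : 10 ≤ n) (hx : x ∈ layerLabels q n)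
    (A : Matrix (Piv (layerVec n x)) (NonPiv (layerVec n x)) F) :
    Module.finrank F (layerSpace off x A) = 4 := by
  obtain ⟨t, ht, -⟩ := exists_isOnes hn hx
  exact ht.finrank_liftSubspace _

/-- The dimension of the code of a layer. -/
theorem finrank_add (hc : IsChoice q n K off) (hn : 10 ≤ n) (hx : x ∈ layerLabels q n) :
    Module.finrank F (K (layerVec n x)) + x.1.2.1 + x.2.1 + x.2.2 + 11 = 3 * n := by
  obtain ⟨t, ht, h0, h1, h2, h3⟩ := exists_isOnes hn hx
  obtain ⟨hl, he⟩ := mem_layerLabels.1 hx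
  obtain ⟨⟨r, s, j⟩, e⟩ := x
  obtain ⟨b1, b2, b3, -⟩ := bounds_of_mem_labels hn hl
  simp only at h0 h1 h2 h3 ⊢
  show Module.finrank F (K (idVec n r s e.1 e.2)) + s + e.1 + e.2 + 11 = 3 * n
  by_cases hs : s = r + 2
  · have hb : ferrersBound (ferrersDiagram (idVec n r s e.1 e.2) \
        pendingDot (idVec n r s e.1 e.2) 2) 2 + t 1 + t 2 + t 3 + 6 = 3 * n :=
      ht.ferrersBound_pending_add (by omega) (by omega)
    have := (hc.pending r s j hl hs e he).2.2
    omega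
  · have hb : ferrersBound (ferrersDiagram (idVec n r s e.1 e.2)) 2 + t 1 + t 2 + t 3 + 6 =
      3 * n := ht.ferrersBound_add (by omega)
    have := ((hc.plain r s j hl hs).2 e he).2.2
    omega

theorem finrank_inf_le_two_of_ne (hc : IsChoice q n K off) (hn : 10 ≤ n)
    (hx : x ∈ layerLabels q n) {A B : Matrix (Piv (layerVec n x)) (NonPiv (layerVec n x)) F}
    (hA : A ∈ K (layerVec n x)) (hB : B ∈ K (layerVec n x)) (hAB : A ≠ B) :
    Module.finrank F (layerSpace off x A ⊓ layerSpace off x B : Submodule F (Fin n → F)) ≤ 2 := by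
  obtain ⟨t, ht, -⟩ := exists_isOnes hn hx
  refine ht.finrank_inf_le_two_of_ne ?_
  rw [add_sub_add_right_eq_sub]
  exact hc.two_le_rank hx hA hB hAB

theorem layerSpace_pending {A : Matrix (Piv (layerVec n x)) (NonPiv (layerVec n x)) F}
    (hc : IsChoice q n K off) (hn : 10 ≤ n) (hx : x ∈ layerLabels q n)
    (hA : A ∈ K (layerVec n x)) (hs : x.1.2.1 = x.1.1 + 2) {z : Fin n → F}
    (hz : z ∈ layerSpace off x A) (i j : Fin n) (hi : (i : ℕ) + 1 = x.1.1) (hj : (j : ℕ) = x.1.1) :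
    z j = z i * off x.1 := by
  obtain ⟨t, ht, h0, h1, -⟩ := exists_isOnes hn hx
  obtain ⟨hl, he⟩ := mem_layerLabels.1 hx
  obtain ⟨⟨r, s, c⟩, e⟩ := x
  obtain ⟨b1, b2, b3, -⟩ := bounds_of_mem_labels hn hl
  simp only at h0 h1 hs hi hj ⊢
  have ht1 : t 0 + 1 < (t 1 : ℕ) := by omega
  have := ht.apply_nextCol_of_mem_liftSubspace ht1 (by omega)
    ((hc.pending _ _ _ hl hs _ he).1 A hA) _ hz
  have hi' : t 0 = i := Fin.ext (by omega)
  have hj' : (ht.nextCol ht1).1 = j := Fin.ext (show (t 0 : ℕ) + 1 = j by omega)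
  rwa [hi', hj'] at this

/-- Subspaces from different layers meet in dimension at most two. Two ones of the identifying
vectors differ in the prefix, or two in the suffix, or one in both; otherwise the prefix is `1010`
or `0101`, the classes are different, and the pending dots take the place of a difference in the
prefix. -/
theorem finrank_inf_le_two (hc : IsChoice q n K off) (hn : 10 ≤ n) (hx : x ∈ layerLabels q n)
    (hy : y ∈ layerLabels q n) (hxy : x ≠ y)
    {A : Matrix (Piv (layerVec n x)) (NonPiv (layerVec n x)) F} (hA : A ∈ K (layerVec n x))
    {B : Matrix (Piv (layerVec n y)) (NonPiv (layerVec n y)) F} (hB : B ∈ K (layerVec n y)) :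
    Module.finrank F (layerSpace off x A ⊓ layerSpace off y B : Submodule F (Fin n → F)) ≤ 2 := by
  have hA' := hc.apply_eq_zero hx hA
  have hB' := hc.apply_eq_zero hy hB
  obtain ⟨t, ht, h0, h1, h2, h3⟩ := exists_isOnes hn hx
  have hpend := fun hs z (hz : z ∈ layerSpace off x A) => hc.layerSpace_pending hn hx hA hs hz
  have hpend' := fun hs z (hz : z ∈ layerSpace off y B) => hc.layerSpace_pending hn hy hB hs hz
  obtain ⟨hl, he⟩ := mem_layerLabels.1 hx
  obtain ⟨hl', he'⟩ := mem_layerLabels.1 hy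
  obtain ⟨⟨r, s, j⟩, e⟩ := x
  obtain ⟨⟨r', s', j'⟩, e'⟩ := y
  simp only at hl hl' he he' h0 h1 h2 h3
  obtain ⟨b1, b2, b3, b4, b5⟩ := bounds_of_mem_labels hn hl
  obtain ⟨b1', b2', b3', b4', b5'⟩ := bounds_of_mem_labels hn hl'
  obtain ⟨c1, c2⟩ := labels_compatible hn hl hl'
  obtain ⟨g1, g2, g3, -⟩ := mem_classEdges.1 he
  obtain ⟨g1', g2', g3', -⟩ := mem_classEdges.1 he'
  have prefix_iff : ∀ i : Fin n, (i : ℕ) < 4 → (layerVec n ⟨(r', s', j'), e'⟩ i = true ↔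
      (i : ℕ) + 1 = r' ∨ (i : ℕ) + 1 = s') := by
    intro i hi
    rw [layerVec, idVec_eq_true_iff]
    dsimp only
    omega
  have suffix_iff : ∀ i : Fin n, 4 ≤ (i : ℕ) → (layerVec n ⟨(r', s', j'), e'⟩ i = true ↔
      (i : ℕ) = e'.1 + 3 ∨ (i : ℕ) = e'.2 + 3) := by
    intro i hi
    rw [layerVec, idVec_eq_true_iff]
    dsimp only
    omega
  have f0 := prefix_iff (t 0) (by omega)
  have f1 := prefix_iff (t 1) (by omega)
  have f2 := suffix_iff (t 2) (by omega)
  have f3 := suffix_iff (t 3) (by omega)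
  by_cases hj : j = j'
  · subst hj
    by_cases hee : e = e'
    · -- Equal edges: the prefixes are complementary.
      subst hee
      have hrs : ¬ (r = r' ∧ s = s') := by
        rintro ⟨rfl, rfl⟩
        exact hxy rfl
      exact ht.finrank_inf_le_two hA' hB' (show (0 : Fin 4) ≠ 1 by decide)
        (fun h => by rw [f0] at h; omega) (fun h => by rw [f1] at h; omega)
    · -- Different edges of a matching are disjoint.
      have hd := disjoint_of_mem_classEdges (by omega) he he' hee
      exact ht.finrank_inf_le_two hA' hB' (show (2 : Fin 4) ≠ 3 by decide)
        (fun h => by rw [f2] at h; omega) (fun h => by rw [f3] at h; omega)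
  · -- Edges of different classes differ in at least one node.
    have hee : e ≠ e' := by
      rintro rfl
      exact hj (index_eq_of_mem_classEdges (by omega) ⟨b4, b5⟩ ⟨b4', b5'⟩ he he')
    have hnode : ∃ l : Fin 4, (l = 2 ∨ l = 3) ∧
        ¬ layerVec n ⟨(r', s', j'), e'⟩ (t l) = true := by
      by_contra! hcon
      have k2 := f2.1 (hcon 2 (Or.inl rfl))
      have k3 := f3.1 (hcon 3 (Or.inr rfl))
      exact hee (Prod.ext (by omega) (by omega))
    obtain ⟨l, hl23, hlf⟩ := hnode
    by_cases hrs : r = r' ∧ s = s'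
    · obtain ⟨rfl, rfl⟩ := hrs
      have hs : s = r + 2 := (c2 ⟨rfl, rfl⟩).resolve_left hj
      refine ht.finrank_inf_le_two hA' hB' (k := 0) (l := l)
        (by rcases hl23 with rfl | rfl <;> decide) (fun _ z hz => ?_) (fun h => absurd h hlf)
      have z1 := hpend hs z hz.1 (t 0) ⟨r, by omega⟩ h0 rfl
      have z2 := hpend' hs z hz.2 (t 0) ⟨r, by omega⟩ h0 rfl
      have hoff : off (r, s, j) ≠ off (r, s, j') := fun h => hj (hc.off_inj r s j j' hl hl' hs h)
      by_contra hne
      exact hoff (mul_left_cancel₀ hne (z1.symm.trans z2))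
    · have hpre : ∃ k : Fin 4, (k = 0 ∨ k = 1) ∧
          ¬ layerVec n ⟨(r', s', j'), e'⟩ (t k) = true := by
        by_contra! hcon
        have k0 := f0.1 (hcon 0 (Or.inl rfl))
        have k1 := f1.1 (hcon 1 (Or.inr rfl))
        exact hrs (by omega)
      obtain ⟨k, hk01, hkf⟩ := hpre
      exact ht.finrank_inf_le_two hA' hB' (k := k) (l := l)
        (by rcases hl23 with rfl | rfl <;> rcases hk01 with rfl | rfl <;> decide)
        (fun h => absurd h hkf) (fun h => absurd h hlf)

theorem finrank_top_inf_le_two (hc : IsChoice q n K off) (hn : 10 ≤ n) (hx : x ∈ layerLabels q n)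
    {A : Matrix (Piv (layerVec n x)) (NonPiv (layerVec n x)) F} (hA : A ∈ K (layerVec n x))
    {B : Matrix (Piv (topVec n)) (NonPiv (topVec n)) F} (hB : B ∈ K (topVec n)) :
    Module.finrank F
      (layerSpace off x A ⊓ liftSubspace (topVec n) B : Submodule F (Fin n → F)) ≤ 2 := by
  obtain ⟨t, ht, h0, h1, h2, h3⟩ := exists_isOnes hn hx
  obtain ⟨hl, he⟩ := mem_layerLabels.1 hx
  obtain ⟨g1, g2, g3, -⟩ := mem_classEdges.1 he
  refine ht.finrank_inf_le_two (hc.apply_eq_zero hx hA) (hc.top.1 B hB)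
    (show (2 : Fin 4) ≠ 3 by decide) (fun h => ?_) (fun h => ?_)
  · rw [topVec_eq_true_iff] at h
    omega
  · rw [topVec_eq_true_iff] at h
    omega

end IsChoice

theorem padZeros_injective (n : ℕ) : Function.Injective (padZeros F 4 n) := by
  intro y z h
  funext i
  have := congrFun h ⟨i.1 + 4, by omega⟩
  simpa [padZeros, concatVec] using this

theorem apply_eq_zero_of_mem_map_padZeros {n : ℕ} {Y : Submodule F (Fin (n - 4) → F)}
    {z : Fin n → F} (hz : z ∈ Y.map (padZeros F 4 n)) {i : Fin n} (hi : (i : ℕ) < 4) :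
    z i = 0 := by
  obtain ⟨y, -, rfl⟩ := hz
  simp [padZeros, concatVec, hi]

theorem finrank_map_padZeros {n : ℕ} (Y : Submodule F (Fin (n - 4) → F)) :
    Module.finrank F (Y.map (padZeros F 4 n)) = Module.finrank F Y :=
  (LinearEquiv.finrank_eq (Submodule.equivMapOfInjective _ (padZeros_injective n) Y)).symm

end Layers

section Code

variable {F : Type*} [Field F] {n : ℕ}

/-- The code of the construction for given rank-metric codes `K` and pending values `off`. -/
def unionCode (q : ℕ) (K : ∀ v : Fin n → Bool, Submodule F (Matrix (Piv v) (NonPiv v) F))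
    (off : ℕ × ℕ × ℕ → F) (S : Set (Submodule F (Fin (n - 4) → F))) :
    Set (Submodule F (Fin n → F)) :=
  (liftSubspace (topVec n) '' (K (topVec n) : Set (Matrix _ _ F)) ∪
    ⋃ x ∈ layerLabels q n, layerSpace off x '' (K (layerVec n x) : Set (Matrix _ _ F))) ∪
      Submodule.map (padZeros F 4 n) '' S

theorem mem_unionCode {q : ℕ} {K : ∀ v : Fin n → Bool, Submodule F (Matrix (Piv v) (NonPiv v) F)}
    {off : ℕ × ℕ × ℕ → F} {S : Set (Submodule F (Fin (n - 4) → F))}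
    {X : Submodule F (Fin n → F)} : X ∈ unionCode q K off S ↔
      (∃ A ∈ K (topVec n), X = liftSubspace (topVec n) A) ∨
      (∃ x ∈ layerLabels q n, ∃ A ∈ K (layerVec n x), X = layerSpace off x A) ∨
      ∃ Y ∈ S, X = Y.map (padZeros F 4 n) := by
  simp only [unionCode, Set.mem_union, Set.mem_image, Set.mem_iUnion, exists_prop, SetLike.mem_coe,
    eq_comm (a := X), or_assoc]

theorem card_piv_topVec (hn : 10 ≤ n) : Fintype.card (Piv (topVec n)) = 4 :=
  (isOnes_topVec (by omega : 4 ≤ n)).card_piv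

theorem card_nonPiv_topVec (hn : 10 ≤ n) : Fintype.card (NonPiv (topVec n)) = n - 4 := by
  have h := Fintype.card_subtype_compl (fun i : Fin n => topVec n i = true)
  have h1 : Fintype.card {i : Fin n // topVec n i = true} = 4 := card_piv_topVec hn
  rw [h1, Fintype.card_fin] at h
  rw [← h]
  exact Fintype.card_congr (Equiv.subtypeEquivRight fun i => by simp)

namespace IsChoice

variable {q : ℕ} {K : ∀ v : Fin n → Bool, Submodule F (Matrix (Piv v) (NonPiv v) F)}
  {off : ℕ × ℕ × ℕ → F} {S : Set (Submodule F (Fin (n - 4) → F))}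

theorem finrank_top (hc : IsChoice q n K off) (hn : 10 ≤ n) :
    Module.finrank F (K (topVec n)) = 3 * (n - 4) := by
  have h := (isOnes_topVec (by omega : 4 ≤ n)).ferrersBound_add (by
    show 0 + 8 ≤ n
    omega)
  have h' : ferrersBound (ferrersDiagram (topVec n)) 2 + 1 + 2 + 3 + 6 = 3 * n := h
  rw [hc.top.2.2]
  omega

theorem finrank_of_mem (hn : 10 ≤ n) (hS : IsConstantDimCode S 2 4)
    {X : Submodule F (Fin n → F)} (hX : X ∈ unionCode q K off S) : Module.finrank F X = 4 := by
  rcases mem_unionCode.1 hX with ⟨A, hA, rfl⟩ | ⟨x, hx, A, hA, rfl⟩ | ⟨Y, hY, rfl⟩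
  · exact (finrank_liftSubspace _ A).trans (card_piv_topVec hn)
  · exact finrank_layerSpace hn hx A
  · rw [finrank_map_padZeros, hS.1 Y hY]

theorem finrank_top_inf_top (hc : IsChoice q n K off) (hn : 10 ≤ n)
    {A B : Matrix (Piv (topVec n)) (NonPiv (topVec n)) F} (hA : A ∈ K (topVec n))
    (hB : B ∈ K (topVec n)) (hAB : A ≠ B) : Module.finrank F
      (liftSubspace (topVec n) A ⊓ liftSubspace (topVec n) B : Submodule F (Fin n → F)) ≤ 2 :=
  (isOnes_topVec (by omega : 4 ≤ n)).finrank_inf_le_two_of_ne (hc.top.2.1 A hA B hB hAB)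

theorem finrank_top_inf_pad (hn : 10 ≤ n) (A : Matrix (Piv (topVec n)) (NonPiv (topVec n)) F)
    (Y : Submodule F (Fin (n - 4) → F)) : Module.finrank F
      (liftSubspace (topVec n) A ⊓ Y.map (padZeros F 4 n) : Submodule F (Fin n → F)) ≤ 2 :=
  (isOnes_topVec (by omega : 4 ≤ n)).finrank_inf_le_two_of_forall_eq_zero A fun _ hz =>
    ⟨apply_eq_zero_of_mem_map_padZeros hz (show 0 < 4 by norm_num),
      apply_eq_zero_of_mem_map_padZeros hz (show 1 < 4 by norm_num)⟩

theorem finrank_layer_inf_pad (hn : 10 ≤ n) {x : Σ _ : ℕ × ℕ × ℕ, ℕ × ℕ}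
    (hx : x ∈ layerLabels q n) (A : Matrix (Piv (layerVec n x)) (NonPiv (layerVec n x)) F)
    (Y : Submodule F (Fin (n - 4) → F)) : Module.finrank F
      (layerSpace off x A ⊓ Y.map (padZeros F 4 n) : Submodule F (Fin n → F)) ≤ 2 := by
  obtain ⟨t, ht, h0, h1, -⟩ := exists_isOnes hn hx
  obtain ⟨hl, -⟩ := mem_layerLabels.1 hx
  have hb := bounds_of_mem_labels hn (r := x.1.1) (s := x.1.2.1) (j := x.1.2.2) hl
  exact ht.finrank_inf_le_two_of_forall_eq_zero _ fun _ hz =>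
    ⟨apply_eq_zero_of_mem_map_padZeros hz (by omega),
      apply_eq_zero_of_mem_map_padZeros hz (by omega)⟩

theorem finrank_pad_inf_pad (hS : IsConstantDimCode S 2 4) {Y Z : Submodule F (Fin (n - 4) → F)}
    (hY : Y ∈ S) (hZ : Z ∈ S) (hYZ : Y ≠ Z) : Module.finrank F
      (Y.map (padZeros F 4 n) ⊓ Z.map (padZeros F 4 n) : Submodule F (Fin n → F)) ≤ 2 := by
  rw [← Submodule.map_inf _ (padZeros_injective n), finrank_map_padZeros]
  have h := hS.2 Y hY Z hZ hYZ
  unfold injectionDist at h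
  rw [hS.1 Y hY, hS.1 Z hZ] at h
  omega

theorem finrank_inf_le_two_of_mem (hc : IsChoice q n K off) (hn : 10 ≤ n)
    (hS : IsConstantDimCode S 2 4) {X Y : Submodule F (Fin n → F)}
    (hX : X ∈ unionCode q K off S) (hY : Y ∈ unionCode q K off S) (hXY : X ≠ Y) :
    Module.finrank F (X ⊓ Y : Submodule F (Fin n → F)) ≤ 2 := by
  rcases mem_unionCode.1 hX with ⟨A, hA, rfl⟩ | ⟨x, hx, A, hA, rfl⟩ | ⟨X', hX', rfl⟩ <;>
  rcases mem_unionCode.1 hY with ⟨B, hB, rfl⟩ | ⟨y, hy, B, hB, rfl⟩ | ⟨Y', hY', rfl⟩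
  · exact hc.finrank_top_inf_top hn hA hB fun h => hXY (h ▸ rfl)
  · rw [inf_comm]
    exact hc.finrank_top_inf_le_two hn hy hB hA
  · exact finrank_top_inf_pad hn A Y'
  · exact hc.finrank_top_inf_le_two hn hx hA hB
  · by_cases hxy : x = y
    · subst hxy
      exact hc.finrank_inf_le_two_of_ne hn hx hA hB fun h => hXY (h ▸ rfl)
    · exact hc.finrank_inf_le_two hn hx hy hxy hA hB
  · exact finrank_layer_inf_pad hn hx A Y'
  · rw [inf_comm]
    exact finrank_top_inf_pad hn B X'
  · rw [inf_comm]
    exact finrank_layer_inf_pad hn hy B X'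
  · exact finrank_pad_inf_pad hS hX' hY' fun h => hXY (h ▸ rfl)

/-- The distance four is attained within the layer of `(1111 || 0…0)`: the code of that layer is
so large that it contains a nonzero matrix with two zero rows. -/
theorem hasMinSubspaceDist (hc : IsChoice q n K off) (hn : 10 ≤ n)
    (hS : IsConstantDimCode S 2 4) : HasMinSubspaceDist (unionCode q K off S) 4 := by
  have ht := isOnes_topVec (by omega : 4 ≤ n)
  constructor
  · obtain ⟨A, hA, hne, h2, h3⟩ := ht.exists_mem_rows_eq_zero (K (topVec n)) (by
      rw [hc.finrank_top hn, card_nonPiv_topVec hn]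
      omega)
    have hle := hc.finrank_top_inf_top hn hA (zero_mem _) hne
    have hge := ht.two_le_finrank_inf (A := A) (B := 0) h2 h3
    refine ⟨_, mem_unionCode.2 (Or.inl ⟨A, hA, rfl⟩), _,
      mem_unionCode.2 (Or.inl ⟨0, zero_mem _, rfl⟩), fun h => ?_, ?_⟩
    · rw [h, inf_idem, ht.finrank_liftSubspace] at hle
      omega
    · unfold subspaceDist
      rw [ht.finrank_liftSubspace, ht.finrank_liftSubspace]
      omega
  · rintro e ⟨X, hX, Y, hY, hXY, rfl⟩
    exact four_le_subspaceDist (finrank_of_mem hn hS hX) (finrank_of_mem hn hS hY)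
      (hc.finrank_inf_le_two_of_mem hn hS hX hY hXY)

theorem ncard_coe_eq_pow [Fintype F] {M : Type*} [AddCommGroup M] [Module F M] [Module.Finite F M]
    (W : Submodule F M) : (W : Set M).ncard = Fintype.card F ^ Module.finrank F W := by
  rw [← Nat.card_eq_fintype_card, ← Module.natCard_eq_pow_finrank]
  rfl

theorem ne_of_finrank_inf_le_two {X Y : Submodule F (Fin n → F)} (hX : Module.finrank F X = 4)
    (h : Module.finrank F (X ⊓ Y : Submodule F (Fin n → F)) ≤ 2) : X ≠ Y := by
  rintro rfl
  rw [inf_idem] at h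
  omega

/-- All lifted subspaces are different, and so are those from different layers. -/
theorem ncard_unionCode [Fintype F] (hc : IsChoice q n K off) (hn : 10 ≤ n) :
    (unionCode q K off S).ncard =
      Fintype.card F ^ (3 * (n - 4)) +
        ∑ x ∈ layerLabels q n, Fintype.card F ^ Module.finrank F (K (layerVec n x)) +
          S.ncard := by
  have htop : ∀ A, Module.finrank F (liftSubspace (topVec n) (A : Matrix _ _ F)) = 4 :=
    fun A => (finrank_liftSubspace _ A).trans (card_piv_topVec hn)
  rw [unionCode, Set.ncard_union_eq, Set.ncard_union_eq]
  · congr 1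
    · congr 1
      · rw [Set.InjOn.ncard_image, ncard_coe_eq_pow, hc.finrank_top hn]
        intro A hA B hB hAB
        by_contra hne
        exact ne_of_finrank_inf_le_two (htop A) (hc.finrank_top_inf_top hn hA hB hne) hAB
      · refine ((Finset.finite_toSet (layerLabels q n)).ncard_biUnion
          (fun _ _ => Set.toFinite _) ?_).trans ?_
        · intro x hx y hy hxy
          refine Set.disjoint_left.2 ?_
          rintro X ⟨A, hA, rfl⟩ ⟨B, hB, hAB⟩
          exact ne_of_finrank_inf_le_two (finrank_layerSpace hn hx A)
            (hc.finrank_inf_le_two hn hx hy hxy hA hB) hAB.symm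
        · rw [finsum_mem_coe_finset]
          refine Finset.sum_congr rfl fun x hx => ?_
          rw [Set.InjOn.ncard_image, ncard_coe_eq_pow]
          intro A hA B hB hAB
          by_contra hne
          exact ne_of_finrank_inf_le_two (finrank_layerSpace hn hx A)
            (hc.finrank_inf_le_two_of_ne hn hx hA hB hne) hAB
    · exact Set.ncard_image_of_injective _
        (Submodule.map_injective_of_injective (padZeros_injective n))
  · refine Set.disjoint_left.2 ?_
    rintro X ⟨A, hA, rfl⟩ hX
    obtain ⟨x, hx, B, hB, hAB⟩ := Set.mem_iUnion₂.1 hX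
    exact ne_of_finrank_inf_le_two (finrank_layerSpace hn hx B)
      (hc.finrank_top_inf_le_two hn hx hB hA) hAB
  · refine Set.disjoint_left.2 ?_
    rintro X (⟨A, hA, rfl⟩ | hX) ⟨Y, hY, hXY⟩
    · exact ne_of_finrank_inf_le_two (htop A) (finrank_top_inf_pad hn A Y) hXY.symm
    · obtain ⟨x, hx, B, hB, rfl⟩ := Set.mem_iUnion₂.1 hX
      exact ne_of_finrank_inf_le_two (finrank_layerSpace hn hx B)
        (finrank_layer_inf_pad hn hx B Y) hXY.symm

end IsChoice

end Code

/-! ### The construction in terms of ordered edges -/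

section Bridge

open ConstructionC4

variable {n : ℕ}

theorem edgeVec_one_two : ![true, true, false, false] = edgeVec 4 1 2 := by decide
theorem edgeVec_three_four : ![false, false, true, true] = edgeVec 4 3 4 := by decide
theorem edgeVec_one_four : ![true, false, false, true] = edgeVec 4 1 4 := by decide
theorem edgeVec_two_three : ![false, true, true, false] = edgeVec 4 2 3 := by decide
theorem edgeVec_one_three : ![true, false, true, false] = edgeVec 4 1 3 := by decide
theorem edgeVec_two_four : ![false, true, false, true] = edgeVec 4 2 4 := by decide

theorem idVec_mem_A1 {r s : ℕ} (hn : 10 ≤ n) (hrs : r = 1 ∧ s = 2 ∨ r = 3 ∧ s = 4)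
    {e : ℕ × ℕ} (he : e ∈ classEdges (n - 4) ((n - 4 + 1) / 2 + 1)) :
    idVec n r s e.1 e.2 ∈ A1 n := by
  refine ⟨edgeVec 4 r s, ?_, _, (mem_oneFactor_iff (by omega) _).2 ⟨e, he, rfl⟩, rfl⟩
  rw [edgeVec_one_two, edgeVec_three_four]
  rcases hrs with ⟨rfl, rfl⟩ | ⟨rfl, rfl⟩ <;> simp

theorem idVec_mem_A2 {r s : ℕ} (hn : 10 ≤ n) (hrs : r = 1 ∧ s = 4 ∨ r = 2 ∧ s = 3)
    {e : ℕ × ℕ} (he : e ∈ classEdges (n - 4) 2) :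
    idVec n r s e.1 e.2 ∈ A2 n := by
  refine ⟨edgeVec 4 r s, ?_, _, (mem_oneFactor_iff (by omega) _).2 ⟨e, he, rfl⟩, rfl⟩
  rw [edgeVec_one_four, edgeVec_two_three]
  rcases hrs with ⟨rfl, rfl⟩ | ⟨rfl, rfl⟩ <;> simp

theorem edgeVec_mem_prefixes3 {r s : ℕ} (hrs : r = 1 ∧ s = 3 ∨ r = 2 ∧ s = 4) :
    edgeVec 4 r s ∈ prefixes3 := by
  rw [prefixes3, edgeVec_one_three, edgeVec_two_four]
  rcases hrs with ⟨rfl, rfl⟩ | ⟨rfl, rfl⟩ <;> simp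

theorem mem_A012_iff (q : ℕ) (hn : 10 ≤ n) (v : Fin n → Bool) : v ∈ A0 n ∪ A1 n ∪ A2 n ↔
    v = topVec n ∨ ∃ r s j, (r, s, j) ∈ labels q n ∧ s ≠ r + 2 ∧
      ∃ e ∈ classEdges (n - 4) j, v = idVec n r s e.1 e.2 := by
  constructor
  · rintro ((rfl | ⟨p, hp, y, hy, rfl⟩) | ⟨p, hp, y, hy, rfl⟩)
    · exact Or.inl rfl
    · obtain ⟨e, he, rfl⟩ := (mem_oneFactor_iff (by omega) _).1 hy
      rw [edgeVec_one_two, edgeVec_three_four] at hp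
      rcases hp with rfl | rfl
      · exact Or.inr ⟨1, 2, _, mem_labels.2 (Or.inl ⟨by omega, rfl⟩), by omega, e, he, rfl⟩
      · exact Or.inr ⟨3, 4, _, mem_labels.2 (Or.inl ⟨by omega, rfl⟩), by omega, e, he, rfl⟩
    · obtain ⟨e, he, rfl⟩ := (mem_oneFactor_iff (by omega) _).1 hy
      rw [edgeVec_one_four, edgeVec_two_three] at hp
      rcases hp with rfl | rfl
      · exact Or.inr ⟨1, 4, _, mem_labels.2 (Or.inr (Or.inl ⟨by omega, rfl⟩)), by omega, e, he, rfl⟩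
      · exact Or.inr ⟨2, 3, _, mem_labels.2 (Or.inr (Or.inl ⟨by omega, rfl⟩)), by omega, e, he, rfl⟩
  · rintro (rfl | ⟨r, s, j, hl, hs, e, he, rfl⟩)
    · exact Or.inl (Or.inl rfl)
    · rcases mem_labels.1 hl with ⟨hrs, rfl⟩ | ⟨hrs, rfl⟩ | ⟨hrs, -⟩
      · exact Or.inl (Or.inr (idVec_mem_A1 hn hrs he))
      · exact Or.inr (idVec_mem_A2 hn hrs he)
      · omega

/-- The prefixes `1010` and `0101` together with the selected classes, as labels. -/
theorem exists_prefixes3_iff (q : ℕ) (hn : 10 ≤ n)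
    (P : (Fin 4 → Bool) → ℕ → (Fin (n - 4) → Bool) → Prop) :
    (∃ p ∈ prefixes3, ∃ j ∈ classIndices q (n - 4), ∃ y ∈ oneFactor (n - 4) j, P p j y) ↔
      ∃ r s j, (r, s, j) ∈ labels q n ∧ s = r + 2 ∧
        ∃ e ∈ classEdges (n - 4) j, P (edgeVec 4 r s) j (edgeVec (n - 4) e.1 e.2) := by
  constructor
  · rintro ⟨p, hp, j, hj, y, hy, h⟩
    obtain ⟨e, he, rfl⟩ := (mem_oneFactor_iff (by omega) _).1 hy
    rw [prefixes3, edgeVec_one_three, edgeVec_two_four] at hp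
    have hj' := mem_classFinset.2 hj
    rcases hp with rfl | rfl
    · exact ⟨1, 3, j, mem_labels.2 (Or.inr (Or.inr ⟨by omega, hj'⟩)), rfl, e, he, h⟩
    · exact ⟨2, 4, j, mem_labels.2 (Or.inr (Or.inr ⟨by omega, hj'⟩)), rfl, e, he, h⟩
  · rintro ⟨r, s, j, hl, hs, e, he, h⟩
    rcases mem_labels.1 hl with ⟨hrs, -⟩ | ⟨hrs, -⟩ | ⟨hrs, hj⟩
    · omega
    · omega
    · exact ⟨_, edgeVec_mem_prefixes3 hrs, j, mem_classFinset.1 hj, _,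
        (mem_oneFactor_iff (by omega) _).2 ⟨e, he, rfl⟩, h⟩

theorem mem_A3_iff (q : ℕ) (hn : 10 ≤ n) (v : Fin n → Bool) : v ∈ A3 q n ↔
    ∃ r s j, (r, s, j) ∈ labels q n ∧ s = r + 2 ∧
      ∃ e ∈ classEdges (n - 4) j, v = idVec n r s e.1 e.2 :=
  exists_prefixes3_iff q hn fun p _ y => v = concatVec p y

theorem not_mem_A3 {q : ℕ} (hn : 10 ≤ n) {v : Fin n → Bool} (hv : v ∈ A0 n ∪ A1 n ∪ A2 n) :
    v ∉ A3 q n := by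
  rintro ⟨p, hp, j, -, y, -, rfl⟩
  rcases hv with (hv | ⟨p', hp', y', -, hv⟩) | ⟨p', hp', y', -, hv⟩
  · have := concatVec_left_inj (by omega) (show concatVec p y = _ from hv)
    subst this
    simp [prefixes3] at hp
  · obtain rfl := concatVec_left_inj (by omega) hv
    rcases hp with rfl | rfl <;> simp at hp'
  · obtain rfl := concatVec_left_inj (by omega) hv
    rcases hp with rfl | rfl <;> simp at hp'

variable {F : Type*} [Field F] [Fintype F] {S : Set (Submodule F (Fin (n - 4) → F))}

theorem exists_isChoice (hn : 10 ≤ n) {C : Set (Submodule F (Fin n → F))} (hC : IsCode n S C) :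
    ∃ K off, IsChoice (Fintype.card F) n K off ∧ C = unionCode (Fintype.card F) K off S := by
  obtain ⟨K, a, h012, h3, ha, rfl⟩ := hC
  refine ⟨K, fun ℓ => if ℓ.2.1 = ℓ.1 + 2 then a (edgeVec 4 ℓ.1 ℓ.2.1) ℓ.2.2 else 0,
    ⟨?_, ?_, ?_, ?_⟩, ?_⟩
  · exact h012 _ ((mem_A012_iff (Fintype.card F) hn _).2 (Or.inl rfl))
  · intro r s j hl hs
    exact ⟨if_neg hs, fun e he => h012 _ ((mem_A012_iff (Fintype.card F) hn _).2
      (Or.inr ⟨r, s, j, hl, hs, e, he, rfl⟩))⟩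
  · intro r s j hl hs e he
    exact h3 _ ((mem_A3_iff _ hn _).2 ⟨r, s, j, hl, hs, e, he, rfl⟩)
  · intro r s j j' hl hl' hs h
    simp only [hs, if_true] at h
    rcases mem_labels.1 hl with ⟨hrs, -⟩ | ⟨hrs, -⟩ | ⟨hrs, hj⟩
    · omega
    · omega
    rcases mem_labels.1 hl' with ⟨hrs', -⟩ | ⟨hrs', -⟩ | ⟨-, hj'⟩
    · omega
    · omega
    exact ha _ (hs ▸ edgeVec_mem_prefixes3 hrs) (mem_classFinset.1 hj) (mem_classFinset.1 hj') h
  · ext X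
    rw [mem_unionCode, ← or_assoc]
    refine or_congr ?_ Iff.rfl
    constructor
    · rintro (⟨v, hv, A, hA, rfl⟩ | h)
      · rcases (mem_A012_iff (Fintype.card F) hn v).1 hv with rfl | ⟨r, s, j, hl, hs, e, he, rfl⟩
        · exact Or.inl ⟨A, hA, rfl⟩
        · refine Or.inr ⟨⟨(r, s, j), e⟩, mem_layerLabels.2 ⟨hl, he⟩, A, hA, ?_⟩
          simp [layerSpace, hs, pendingMatrix_zero]
      · obtain ⟨r, s, j, hl, hs, e, he, A, hA, rfl⟩ := (exists_prefixes3_iff _ hn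
          fun p j y => ∃ A ∈ K (concatVec p y), X =
            liftSubspace (concatVec p y) (A + pendingMatrix (concatVec p y) 2 (a p j))).1 h
        refine Or.inr ⟨⟨(r, s, j), e⟩, mem_layerLabels.2 ⟨hl, he⟩, A, hA, ?_⟩
        simp only [layerSpace, hs, if_true]
        rfl
    · rintro (⟨A, hA, rfl⟩ | ⟨⟨⟨r, s, j⟩, e⟩, hx, A, hA, rfl⟩)
      · exact Or.inl ⟨_, (mem_A012_iff (Fintype.card F) hn _).2 (Or.inl rfl), A, hA, rfl⟩
      · obtain ⟨hl, he⟩ := mem_layerLabels.1 hx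
        by_cases hs : s = r + 2
        · refine Or.inr ((exists_prefixes3_iff _ hn fun p j y => ∃ A ∈ K (concatVec p y), _ =
            liftSubspace (concatVec p y) (A + pendingMatrix (concatVec p y) 2 (a p j))).2
            ⟨r, s, j, hl, hs, e, he, A, hA, ?_⟩)
          simp only [layerSpace, hs, if_true]
          rfl
        · refine Or.inl ⟨_, (mem_A012_iff (Fintype.card F) hn _).2
            (Or.inr ⟨r, s, j, hl, hs, e, he, rfl⟩), A, hA, ?_⟩
          simp [layerSpace, hs, pendingMatrix_zero]

theorem exists_isFDMRD_of_mem_A012 (hn : 10 ≤ n) {v : Fin n → Bool}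
    (hv : v ∈ A0 n ∪ A1 n ∪ A2 n) :
    ∃ K : Submodule F (Matrix (Piv v) (NonPiv v) F), IsFDMRD (ferrersDiagram v) 2 K := by
  rcases (mem_A012_iff 0 hn v).1 hv with rfl | ⟨r, s, j, hl, -, e, he, rfl⟩
  · exact (isOnes_topVec (by omega : 4 ≤ n)).exists_isFDMRD (by
      show 0 + 8 ≤ n
      omega)
  · obtain ⟨b1, b2, b3, -⟩ := bounds_of_mem_labels hn hl
    obtain ⟨g1, g2, g3, -⟩ := mem_classEdges.1 he
    obtain ⟨t, ht, h0, -⟩ := exists_isOnes_idVec b1 b2 b3 g1 g2 g3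
    exact ht.exists_isFDMRD (by omega)

theorem exists_isFDMRD_of_mem_A3 (hn : 10 ≤ n) {q : ℕ} {v : Fin n → Bool} (hv : v ∈ A3 q n) :
    ∃ K : Submodule F (Matrix (Piv v) (NonPiv v) F),
      IsFDMRD (ferrersDiagram v \ pendingDot v 2) 2 K := by
  obtain ⟨r, s, j, hl, hs, e, he, rfl⟩ := (mem_A3_iff q hn v).1 hv
  obtain ⟨b1, b2, b3, -⟩ := bounds_of_mem_labels hn hl
  obtain ⟨g1, g2, g3, -⟩ := mem_classEdges.1 he
  obtain ⟨t, ht, h0, h1, -⟩ := exists_isOnes_idVec b1 b2 b3 g1 g2 g3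
  exact ht.exists_isFDMRD_pending (by omega) (by omega)

/-- The construction can be carried out; in particular there are enough field elements for the
classes. -/
theorem exists_isCode (hn : 10 ≤ n) (S : Set (Submodule F (Fin (n - 4) → F))) :
    ∃ C : Set (Submodule F (Fin n → F)), IsCode n S C := by
  classical
  have hK : ∀ v : Fin n → Bool, ∃ K : Submodule F (Matrix (Piv v) (NonPiv v) F),
      (v ∈ A0 n ∪ A1 n ∪ A2 n → IsFDMRD (ferrersDiagram v) 2 K) ∧
      (v ∈ A3 (Fintype.card F) n → IsFDMRD (ferrersDiagram v \ pendingDot v 2) 2 K) := by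
    intro v
    by_cases hv : v ∈ A0 n ∪ A1 n ∪ A2 n
    · obtain ⟨K, hK⟩ := exists_isFDMRD_of_mem_A012 (F := F) hn hv
      exact ⟨K, fun _ => hK, fun h => absurd h (not_mem_A3 hn hv)⟩
    · by_cases h3 : v ∈ A3 (Fintype.card F) n
      · obtain ⟨K, hK⟩ := exists_isFDMRD_of_mem_A3 (F := F) hn h3
        exact ⟨K, fun h => absurd h hv, fun _ => hK⟩
      · exact ⟨⊥, fun h => absurd h hv, fun h => absurd h h3⟩
  choose K h012 h3 using hK
  obtain ⟨g⟩ := Function.Embedding.nonempty_of_card_le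
    (α := classFinset (Fintype.card F) (n - 4)) (β := F) (by
      rw [Fintype.card_coe]
      exact card_classFinset_le _ _ (by omega))
  refine ⟨_, K, fun _ j => if h : j ∈ classFinset (Fintype.card F) (n - 4) then g ⟨j, h⟩ else 0,
    h012, h3, fun p _ j hj j' hj' h => ?_, rfl⟩
  have hj := mem_classFinset.2 hj
  have hj' := mem_classFinset.2 hj'
  simp only [hj, hj', dif_pos] at h
  exact congrArg Subtype.val (g.injective h)

end Bridge

/-! ### Evaluation of the cardinality -/

section Cardinality

variable {q : ℕ}

theorem zpow_mul_zpow_eq (hq : (q : ℚ) ≠ 0) {a b c : ℤ} (h : a + b = c) :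
    (q : ℚ) ^ a * (q : ℚ) ^ b = (q : ℚ) ^ c := by
  rw [← zpow_add₀ hq, h]

/-- The sum of `q ^ (2n - 9 - (a + b))` over the edges `{a, b}` of the class `P_j`. -/
def classWeight (q n j : ℕ) : ℚ :=
  ∑ e ∈ classEdges (n - 4) j, (q : ℚ) ^ (2 * (n : ℤ) - 9 - (e.1 + e.2 : ℕ))

/-- The class `P_{⌈n'/2⌉ + i}` for even `n`. In the extreme case `i = n'/2` this is `P_1`, which has
`i - 1` instead of `i` edges `{a, b}` with `a + b = 2i + 1` on the circle, but its edge at the central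
node has this sum too; the last two terms on the right cancel. -/
theorem classWeight_upper_even {n i : ℕ} (hn : 10 ≤ n) (he : Even n)
    (hi : 1 ≤ i) (hi2 : i ≤ (n - 4) / 2) :
    classWeight q n ((n - 4 + 1) / 2 + i) = (i : ℚ) * (q : ℚ) ^ (2 * (n : ℤ) - 2 * i - 10)
      + (((n : ℚ) - 6) / 2 - i) * (q : ℚ) ^ ((n : ℤ) - 2 * i - 5)
      + (q : ℚ) ^ (((n : ℤ) - 6) / 2 - i) := by
  obtain ⟨k, rfl⟩ := he
  obtain ⟨l, rfl⟩ : ∃ l, k = l + 5 := ⟨k - 5, by omega⟩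
  have hcirc : circ (l + 5 + (l + 5) - 4) = 2 * l + 5 := by unfold circ; omega
  have hc : (l + 5 + (l + 5) - 4 + 1) / 2 = l + 3 := by omega
  rw [classWeight, hc]
  by_cases hlast : i = l + 3
  · subst hlast
    rw [sum_classEdges (s := 2 * (l + 3) + 1) (a := 1) (by omega) (by
        rw [hcirc, Nat.modEq_iff_dvd]
        exact ⟨1, by push_cast; ring⟩) (by omega) (by omega) (by
        rw [hcirc, Nat.modEq_iff_dvd]
        exact ⟨1, by push_cast; ring⟩) (by omega) (by omega)
      (fun T => (q : ℚ) ^ (2 * ((l + 5 + (l + 5) : ℕ) : ℤ) - 9 - (T : ℕ))), hcirc,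
      if_pos (by omega),
      show (2 * (l + 3) + 1 - 1) / 2 + 1 - max 1 (2 * (l + 3) + 1 - (2 * l + 5)) = l + 2 by omega,
      show (2 * (l + 3) + 1 + (2 * l + 5) - 1) / 2 + 1 - max 1 (2 * (l + 3) + 1) = 0 by omega,
      show 2 * ((l + 5 + (l + 5) : ℕ) : ℤ) - 9 - (2 * (l + 3) + 1 : ℕ) =
        2 * ((l + 5 + (l + 5) : ℕ) : ℤ) - 2 * ((l + 3 : ℕ) : ℤ) - 10 by push_cast; ring,
      show 2 * ((l + 5 + (l + 5) : ℕ) : ℤ) - 9 - (1 + (l + 5 + (l + 5) - 4) : ℕ) =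
        2 * ((l + 5 + (l + 5) : ℕ) : ℤ) - 2 * ((l + 3 : ℕ) : ℤ) - 10 by omega,
      show ((l + 5 + (l + 5) : ℕ) : ℤ) - 2 * ((l + 3 : ℕ) : ℤ) - 5 = -1 by push_cast; ring,
      show (((l + 5 + (l + 5) : ℕ) : ℤ) - 6) / 2 - ((l + 3 : ℕ) : ℤ) = -1 by omega]
    push_cast
    ring
  · rw [sum_classEdges (s := 2 * i + 1) (a := l + 3 + i) (by omega) (by
        rw [hcirc, Nat.modEq_iff_dvd]
        exact ⟨1, by push_cast; ring⟩) (by omega) (by omega) rfl (by omega) (by omega)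
      (fun T => (q : ℚ) ^ (2 * ((l + 5 + (l + 5) : ℕ) : ℤ) - 9 - (T : ℕ))), hcirc,
      if_pos (by omega),
      show (2 * i + 1 - 1) / 2 + 1 - max 1 (2 * i + 1 - (2 * l + 5)) = i by omega,
      show (2 * i + 1 + (2 * l + 5) - 1) / 2 + 1 - max 1 (2 * i + 1) = l + 2 - i by omega,
      Nat.cast_sub (by omega : i ≤ l + 2),
      show 2 * ((l + 5 + (l + 5) : ℕ) : ℤ) - 9 - (2 * i + 1 : ℕ) =
        2 * ((l + 5 + (l + 5) : ℕ) : ℤ) - 2 * (i : ℤ) - 10 by push_cast; ring,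
      show 2 * ((l + 5 + (l + 5) : ℕ) : ℤ) - 9 - (2 * i + 1 + (2 * l + 5) : ℕ) =
        ((l + 5 + (l + 5) : ℕ) : ℤ) - 2 * (i : ℤ) - 5 by push_cast; ring,
      show 2 * ((l + 5 + (l + 5) : ℕ) : ℤ) - 9 - (l + 3 + i + (l + 5 + (l + 5) - 4) : ℕ) =
        (((l + 5 + (l + 5) : ℕ) : ℤ) - 6) / 2 - (i : ℤ) by omega]
    push_cast
    ring

theorem classWeight_lower_even {n i : ℕ} (hn : 10 ≤ n) (he : Even n)
    (hi : 1 ≤ i) (hi2 : i ≤ (n - 4 + 1) / 2 - 1) :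
    classWeight q n (i + 1) = (i : ℚ) * (q : ℚ) ^ (2 * (n : ℤ) - 2 * i - 11)
      + (((n : ℚ) - 6) / 2 - i) * (q : ℚ) ^ ((n : ℤ) - 2 * i - 6)
      + (q : ℚ) ^ ((n : ℤ) - i - 6) := by
  obtain ⟨k, rfl⟩ := he
  obtain ⟨l, rfl⟩ : ∃ l, k = l + 5 := ⟨k - 5, by omega⟩
  have hcirc : circ (l + 5 + (l + 5) - 4) = 2 * l + 5 := by unfold circ; omega
  rw [classWeight, sum_classEdges (s := 2 * i + 2) (a := i + 1) (by omega)
      (Nat.ModEq.refl (2 * i + 2)) (by omega) (by omega) rfl (by omega) (by omega)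
      (fun T => (q : ℚ) ^ (2 * ((l + 5 + (l + 5) : ℕ) : ℤ) - 9 - (T : ℕ))), hcirc,
    if_pos (by omega),
    show (2 * i + 2 - 1) / 2 + 1 - max 1 (2 * i + 2 - (2 * l + 5)) = i by omega,
    show (2 * i + 2 + (2 * l + 5) - 1) / 2 + 1 - max 1 (2 * i + 2) = l + 2 - i by omega,
    Nat.cast_sub (by omega : i ≤ l + 2),
    show 2 * ((l + 5 + (l + 5) : ℕ) : ℤ) - 9 - (2 * i + 2 : ℕ) =
      2 * ((l + 5 + (l + 5) : ℕ) : ℤ) - 2 * (i : ℤ) - 11 by push_cast; ring,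
    show 2 * ((l + 5 + (l + 5) : ℕ) : ℤ) - 9 - (2 * i + 2 + (2 * l + 5) : ℕ) =
      ((l + 5 + (l + 5) : ℕ) : ℤ) - 2 * (i : ℤ) - 6 by push_cast; ring,
    show 2 * ((l + 5 + (l + 5) : ℕ) : ℤ) - 9 - (i + 1 + (l + 5 + (l + 5) - 4) : ℕ) =
      ((l + 5 + (l + 5) : ℕ) : ℤ) - (i : ℤ) - 6 by omega]
  push_cast
  ring

theorem classWeight_upper_odd {n i : ℕ} (hn : 10 ≤ n) (ho : Odd n) (hi : 1 ≤ i)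
    (hi2 : i ≤ (n - 4) / 2) :
    classWeight q n ((n - 4 + 1) / 2 + i) = (i : ℚ) * (q : ℚ) ^ (2 * (n : ℤ) - 2 * i - 10)
      + (((n : ℚ) - 5) / 2 - i) * (q : ℚ) ^ ((n : ℤ) - 2 * i - 6) := by
  obtain ⟨k, rfl⟩ := ho
  obtain ⟨l, rfl⟩ : ∃ l, k = l + 5 := ⟨k - 5, by omega⟩
  have hcirc : circ (2 * (l + 5) + 1 - 4) = 2 * l + 7 := by unfold circ; omega
  have hc : (2 * (l + 5) + 1 - 4 + 1) / 2 = l + 4 := by omega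
  rw [classWeight, hc, sum_classEdges (s := 2 * i + 1) (a := l + 4 + i) (by omega) (by
        rw [hcirc, Nat.modEq_iff_dvd]
        exact ⟨1, by push_cast; ring⟩) (by omega) (by omega) rfl (by omega) (by omega)
      (fun T => (q : ℚ) ^ (2 * ((2 * (l + 5) + 1 : ℕ) : ℤ) - 9 - (T : ℕ))), hcirc,
    if_neg (by omega),
    show (2 * i + 1 - 1) / 2 + 1 - max 1 (2 * i + 1 - (2 * l + 7)) = i by omega,
    show (2 * i + 1 + (2 * l + 7) - 1) / 2 + 1 - max 1 (2 * i + 1) = l + 3 - i by omega,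
    Nat.cast_sub (by omega : i ≤ l + 3),
    show 2 * ((2 * (l + 5) + 1 : ℕ) : ℤ) - 9 - (2 * i + 1 : ℕ) =
      2 * ((2 * (l + 5) + 1 : ℕ) : ℤ) - 2 * (i : ℤ) - 10 by push_cast; ring,
    show 2 * ((2 * (l + 5) + 1 : ℕ) : ℤ) - 9 - (2 * i + 1 + (2 * l + 7) : ℕ) =
      ((2 * (l + 5) + 1 : ℕ) : ℤ) - 2 * (i : ℤ) - 6 by push_cast; ring]
  push_cast
  ring

theorem classWeight_lower_odd {n i : ℕ} (hn : 10 ≤ n) (ho : Odd n) (hi : 1 ≤ i)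
    (hi2 : i ≤ (n - 4 + 1) / 2 - 1) :
    classWeight q n (i + 1) = (i : ℚ) * (q : ℚ) ^ (2 * (n : ℤ) - 2 * i - 11)
      + (((n : ℚ) - 5) / 2 - i) * (q : ℚ) ^ ((n : ℤ) - 2 * i - 7) := by
  obtain ⟨k, rfl⟩ := ho
  obtain ⟨l, rfl⟩ : ∃ l, k = l + 5 := ⟨k - 5, by omega⟩
  have hcirc : circ (2 * (l + 5) + 1 - 4) = 2 * l + 7 := by unfold circ; omega
  rw [classWeight, sum_classEdges (s := 2 * i + 2) (a := i + 1) (by omega)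
      (Nat.ModEq.refl (2 * i + 2)) (by omega) (by omega) rfl (by omega) (by omega)
      (fun T => (q : ℚ) ^ (2 * ((2 * (l + 5) + 1 : ℕ) : ℤ) - 9 - (T : ℕ))), hcirc,
    if_neg (by omega),
    show (2 * i + 2 - 1) / 2 + 1 - max 1 (2 * i + 2 - (2 * l + 7)) = i by omega,
    show (2 * i + 2 + (2 * l + 7) - 1) / 2 + 1 - max 1 (2 * i + 2) = l + 3 - i by omega,
    Nat.cast_sub (by omega : i ≤ l + 3),
    show 2 * ((2 * (l + 5) + 1 : ℕ) : ℤ) - 9 - (2 * i + 2 : ℕ) =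
      2 * ((2 * (l + 5) + 1 : ℕ) : ℤ) - 2 * (i : ℤ) - 11 by push_cast; ring,
    show 2 * ((2 * (l + 5) + 1 : ℕ) : ℤ) - 9 - (2 * i + 2 + (2 * l + 7) : ℕ) =
      ((2 * (l + 5) + 1 : ℕ) : ℤ) - 2 * (i : ℤ) - 7 by push_cast; ring]
  push_cast
  ring

/-- The number of subspaces lifted in the layers with prefixes of weight two. The class `P_2` is the
term `i = 1` of the last sum, because `1001` and `0110` contribute the same powers as `1010` and
`0101`. -/
theorem sum_layerLabels {F : Type*} [Field F] {n : ℕ}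
    {K : ∀ v : Fin n → Bool, Submodule F (Matrix (Piv v) (NonPiv v) F)} {off : ℕ × ℕ × ℕ → F}
    (hc : IsChoice q n K off) (hn : 10 ≤ n) (hq : (q : ℚ) ≠ 0) :
    ∑ x ∈ layerLabels q n, (q : ℚ) ^ Module.finrank F (K (layerVec n x)) =
      ((q : ℚ) ^ ((n : ℤ) - 4) + (q : ℚ) ^ ((n : ℤ) - 6)) *
          classWeight q n ((n - 4 + 1) / 2 + 1)
        + ((q : ℚ) ^ ((n : ℤ) - 5) + (q : ℚ) ^ ((n : ℤ) - 6)) *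
          (∑ i ∈ Finset.Icc 2 (min ((q + 1) / 2 + 1) ((n - 4) / 2)),
              classWeight q n ((n - 4 + 1) / 2 + i)
            + ∑ i ∈ Finset.Icc 1 (min (q / 2 + 1) ((n - 4 + 1) / 2 - 1)),
              classWeight q n (i + 1)) := by
  have hterm : ∀ x ∈ layerLabels q n, (q : ℚ) ^ Module.finrank F (K (layerVec n x)) =
      (q : ℚ) ^ ((n : ℤ) - 2 - x.1.2.1) *
        (q : ℚ) ^ (2 * (n : ℤ) - 9 - (x.2.1 + x.2.2 : ℕ)) := by
    intro x hx
    have := hc.finrank_add hn hx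
    rw [zpow_mul_zpow_eq hq rfl, ← zpow_natCast]
    congr 1
    omega
  have hfac : ∀ s j : ℕ, ∑ e ∈ classEdges (n - 4) j, (q : ℚ) ^ ((n : ℤ) - 2 - s) *
      (q : ℚ) ^ (2 * (n : ℤ) - 9 - (e.1 + e.2 : ℕ)) =
        (q : ℚ) ^ ((n : ℤ) - 2 - s) * classWeight q n j := fun s j => (Finset.mul_sum _ _ _).symm
  have hshift : ∑ i ∈ Finset.Icc 1 (min (q / 2 + 1) ((n - 4 + 1) / 2 - 1)), classWeight q n (i + 1)
      = classWeight q n 2 +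
        ∑ j ∈ Finset.Icc 3 (min (q / 2 + 2) ((n - 4 + 1) / 2)), classWeight q n j := by
    have hmin : min (q / 2 + 2) ((n - 4 + 1) / 2) =
        min (q / 2 + 1) ((n - 4 + 1) / 2 - 1) + 1 := by omega
    rw [← Finset.add_sum_Ioc_eq_sum_Icc (by omega), hmin]
    congr 1
    refine Finset.sum_bij (fun i _ => i + 1) (fun i hi => ?_) (fun a _ b _ h => by omega)
      (fun j hj => ⟨j - 1, ?_, ?_⟩) fun _ _ => rfl
    · rw [Finset.mem_Ioc] at hi
      rw [Finset.mem_Icc]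
      omega
    · rw [Finset.mem_Icc] at hj
      rw [Finset.mem_Ioc]
      omega
    · rw [Finset.mem_Icc] at hj
      omega
  have hsig : ∑ x ∈ layerLabels q n, (q : ℚ) ^ ((n : ℤ) - 2 - x.1.2.1) *
        (q : ℚ) ^ (2 * (n : ℤ) - 9 - (x.2.1 + x.2.2 : ℕ)) =
      ∑ ℓ ∈ labels q n, (q : ℚ) ^ ((n : ℤ) - 2 - ℓ.2.1) * classWeight q n ℓ.2.2 := by
    simp_rw [← hfac]
    unfold layerLabels
    exact Finset.sum_sigma _ _ _
  rw [Finset.sum_congr rfl hterm, hsig, sum_labels, hshift]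
  simp only [Nat.cast_ofNat, ← add_mul]
  rw [← Finset.mul_sum, sum_classFinset, show (n : ℤ) - 2 - 2 = n - 4 by ring,
    show (n : ℤ) - 2 - 4 = n - 6 by ring, show (n : ℤ) - 2 - 3 = n - 5 by ring]
  ring

end Cardinality

theorem mainTheorem8 {F : Type*} [Field F] [Fintype F] (q : ℕ) (hq : Fintype.card F = q)
    (n : ℕ) (hn : 10 ≤ n) (S : Set (Submodule F (Fin (n - 4) → F)))
    (hS : IsConstantDimCode S 2 4) :
    (∃ C : Set (Submodule F (Fin n → F)), ConstructionC4.IsCode n S C) ∧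
    ∀ C : Set (Submodule F (Fin n → F)), ConstructionC4.IsCode n S C →
      (∀ X ∈ C, Module.finrank F X = 4) ∧
      HasMinSubspaceDist C 4 ∧
      (Even n →
        (C.ncard : ℚ) =
          (q : ℚ) ^ (3 * ((n : ℤ) - 4))
          + ((q : ℚ) ^ ((n : ℤ) - 4) + (q : ℚ) ^ ((n : ℤ) - 6)) *
            ((q : ℚ) ^ (2 * ((n : ℤ) - 6)) + ((n : ℚ) / 2 - 4) * (q : ℚ) ^ ((n : ℤ) - 7)
              + (q : ℚ) ^ ((n : ℤ) / 2 - 4))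
          + ((q : ℚ) ^ ((n : ℤ) - 5) + (q : ℚ) ^ ((n : ℤ) - 6)) *
            ((∑ i ∈ Finset.Icc 2 (min ((q + 1) / 2 + 1) ((n - 4) / 2)),
                ((i : ℚ) * (q : ℚ) ^ (2 * (n : ℤ) - 2 * i - 10)
                  + (((n : ℚ) - 6) / 2 - i) * (q : ℚ) ^ ((n : ℤ) - 2 * i - 5)
                  + (q : ℚ) ^ (((n : ℤ) - 6) / 2 - i)))
              + ∑ i ∈ Finset.Icc 1 (min (q / 2 + 1) ((n - 4 + 1) / 2 - 1)),
                ((i : ℚ) * (q : ℚ) ^ (2 * (n : ℤ) - 2 * i - 11)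
                  + (((n : ℚ) - 6) / 2 - i) * (q : ℚ) ^ ((n : ℤ) - 2 * i - 6)
                  + (q : ℚ) ^ ((n : ℤ) - i - 6)))
          + (S.ncard : ℚ)) ∧
      (Odd n →
        (C.ncard : ℚ) =
          (q : ℚ) ^ (3 * ((n : ℤ) - 4))
          + ((q : ℚ) ^ ((n : ℤ) - 4) + (q : ℚ) ^ ((n : ℤ) - 6)) *
            ((q : ℚ) ^ (2 * ((n : ℤ) - 6)) + (((n : ℚ) - 7) / 2) * (q : ℚ) ^ ((n : ℤ) - 8))
          + ((q : ℚ) ^ ((n : ℤ) - 5) + (q : ℚ) ^ ((n : ℤ) - 6)) *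
            ((∑ i ∈ Finset.Icc 2 (min ((q + 1) / 2 + 1) ((n - 4) / 2)),
                ((i : ℚ) * (q : ℚ) ^ (2 * (n : ℤ) - 2 * i - 10)
                  + (((n : ℚ) - 5) / 2 - i) * (q : ℚ) ^ ((n : ℤ) - 2 * i - 6)))
              + ∑ i ∈ Finset.Icc 1 (min (q / 2 + 1) ((n - 4 + 1) / 2 - 1)),
                ((i : ℚ) * (q : ℚ) ^ (2 * (n : ℤ) - 2 * i - 11)
                  + (((n : ℚ) - 5) / 2 - i) * (q : ℚ) ^ ((n : ℤ) - 2 * i - 7)))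
          + (S.ncard : ℚ)) := by 
  subst hq
  refine ⟨exists_isCode hn S, fun C hC => ?_⟩
  obtain ⟨K, off, hc, rfl⟩ := exists_isChoice hn hC
  have hq : (Fintype.card F : ℚ) ≠ 0 := Nat.cast_ne_zero.2 Fintype.card_ne_zero
  refine ⟨fun X hX => IsChoice.finrank_of_mem hn hS hX, hc.hasMinSubspaceDist hn hS,
    fun he => ?_, fun ho => ?_⟩
  all_goals
    rw [hc.ncard_unionCode hn, Nat.cast_add, Nat.cast_add, Nat.cast_pow, Nat.cast_sum]
    simp_rw [Nat.cast_pow]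
    rw [sum_layerLabels hc hn hq, ← zpow_natCast,
      show ((3 * (n - 4) : ℕ) : ℤ) = 3 * ((n : ℤ) - 4) by omega, ← add_assoc]
    congr 2
  · congr 2
    rw [classWeight_upper_even hn he le_rfl (by omega), Nat.cast_one, one_mul,
      show 2 * (n : ℤ) - 2 * (1 : ℕ) - 10 = 2 * ((n : ℤ) - 6) by push_cast; ring,
      show (n : ℤ) - 2 * (1 : ℕ) - 5 = n - 7 by push_cast; ring,
      show ((n : ℤ) - 6) / 2 - (1 : ℕ) = (n : ℤ) / 2 - 4 by omega]
    ring
  · congr 2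
    · refine Finset.sum_congr rfl fun i hi => ?_
      rw [Finset.mem_Icc] at hi
      exact classWeight_upper_even hn he (by omega) (by omega)
    · refine Finset.sum_congr rfl fun i hi => ?_
      rw [Finset.mem_Icc] at hi
      exact classWeight_lower_even hn he (by omega) (by omega)
  · congr 2
    rw [classWeight_upper_odd hn ho le_rfl (by omega), Nat.cast_one, one_mul,
      show 2 * (n : ℤ) - 2 * (1 : ℕ) - 10 = 2 * ((n : ℤ) - 6) by push_cast; ring,
      show (n : ℤ) - 2 * (1 : ℕ) - 6 = n - 8 by push_cast; ring]
    ring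
  · congr 2
    · refine Finset.sum_congr rfl fun i hi => ?_
      rw [Finset.mem_Icc] at hi
      exact classWeight_upper_odd hn ho (by omega) (by omega)
    · refine Finset.sum_congr rfl fun i hi => ?_
      rw [Finset.mem_Icc] at hi
      exact classWeight_lower_odd hn ho (by omega) (by omega)
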